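/- **Model.** A $k$-unicast instance consists of a finite connected undirected graph $G=(V,E)$ with integer edge capacities $c_e\ge 1$ and $k$ sessions $(s_i,t_i,d_i)$, $i\in[k]$, where the source $s_i\in V$ holds a packet of $d_i\ge 1$ sub-packets, each a symbol of a finite alphabet $\Gamma$ with $|\Gamma|\ge 2$, that has to reach the sink $t_i\in V$. The instance is *simple* if all $c_e=1$ and all $d_i=1$. A (network coding) *protocol* works in synchronous rounds. In each round every node sends along each incident edge $e$ a word of $c_e$ symbols of $\Gamma$ (so $e$ is used in both directions), which is a predetermined function of the packets originating at that node and of the words it received in earlier rounds. A *routing* protocol is a protocol in which each symbol sent is either a sub-packet that originates at the sending node or was forwarded to it in an earlier round, or is idle (a constant). A protocol has *completion times* $(T_1,\dots,T_k)\in\mathbb Z_{\ge 0}^k$ if for every $i$, the packet of session $i$ is determined by what $t_i$ knows after $T_i$ rounds. For $p\in(0,\infty]$, the *$\ell_p$-coding gap* of an instance (over $\Gamma$) is the smallest value of $\|(T_1,\dots,T_k)\|_p$ over all completion times of routing protocols divided by the smallest value over all completion times of protocols, where $\|T\|_p=(\sum_i T_i^p)^{1/p}$ for $p<\infty$ and $\|T\|_\infty=\max_i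 T_i$. **Theorem.** There are an absolute constant $c>0$ and an infinite sequence $\mathcal M_1,\mathcal M_2,\dots$ of simple unicast instances, with numbers of sessions $k_n\to\infty$, whose $\ell_p$-coding gaps are $\Omega(\log^c k_n)$ for all $p$ simultaneously. Precisely: for every $p_0\in(0,\infty]$ there is a constant $C>0$ such that for every $p\in[p_0,\infty]$, every finite alphabet $\Gamma$ with at least two symbols and every $n$, the $\ell_p$-coding gap of $\mathcal M_n$ over $\Gamma$ is at least $C\,(\log k_n)^{c}$. (In particular, with $p_0=1$, the constant is absolute for all norms $\ell_p$, $1\le p\le\infty$.) -/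

import Mathlib

open scoped ENNReal

/-- A multiple-unicast instance: a finite connected undirected network whose edges have integral
capacities at least one, and `k` sessions, each consisting of a source, a sink and a number
`demand i ≥ 1` of sub-packets to be sent from the source to the sink. -/
structure UnicastInstance where
  V : Type
  finite : Finite V
  G : SimpleGraph V
  connected : G.Connected
  cap : Sym2 V → ℕ
  one_le_cap : ∀ e ∈ G.edgeSet, 1 ≤ cap e
  k : ℕ
  src : Fin k → V
  snk : Fin k → V
  demand : Fin k → ℕ
  one_le_demand : ∀ i, 1 ≤ demand i

namespace UnicastInstance

/-- All capacities and all demands are equal to one. -/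
def IsSimple (M : UnicastInstance) : Prop :=
  (∀ e ∈ M.G.edgeSet, M.cap e = 1) ∧ ∀ i, M.demand i = 1

/-- The contents of all packets: `x i j` is the `j`-th sub-packet of session `i`, a symbol of the
alphabet `Γ`. -/
abbrev Messages (M : UnicastInstance) (Γ : Type) : Type :=
  (i : Fin M.k) → Fin (M.demand i) → Γ

/-- Suppose that in round `r` (the rounds are numbered `0, 1, 2, …`) the word `send d r x` is sent
along the arc `d` when the packets are `x`. Then `SameHistory send u r x y` says that `x` and `y`
are indistinguishable at the node `u` just before round `r`: the packets originating at `u` agree,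
and so does everything that `u` received in the rounds before `r`. -/
def SameHistory {M : UnicastInstance} {Γ : Type}
    (send : (d : M.G.Dart) → ℕ → M.Messages Γ → Fin (M.cap d.edge) → Γ)
    (u : M.V) (r : ℕ) (x y : M.Messages Γ) : Prop :=
  (∀ i, M.src i = u → x i = y i) ∧
    ∀ d : M.G.Dart, d.snd = u → ∀ r' < r, send d r' x = send d r' y

/-- A network coding protocol over the alphabet `Γ`. In each round, each node sends along each of
its edges `e` a word of `cap e` symbols (so each edge is used in both directions), which is a
function of the packets originating at the node and of what it received in earlier rounds.
Rounds after the last completion time are irrelevant, so no last round is fixed. -/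
structure Protocol (M : UnicastInstance) (Γ : Type) where
  send : (d : M.G.Dart) → ℕ → M.Messages Γ → Fin (M.cap d.edge) → Γ
  causal : ∀ (d : M.G.Dart) (r : ℕ) (x y : M.Messages Γ),
    SameHistory send d.fst r x y → send d r x = send d r y

namespace Protocol

variable {M : UnicastInstance} {Γ : Type}

/-- The protocol has completion times `T`: for each session `i`, after `T i` rounds the packet of
session `i` is determined by what its sink knows. -/
def HasCompletionTimes (P : M.Protocol Γ) (T : Fin M.k → ℕ) : Prop :=
  ∀ (i : Fin M.k) (x y : M.Messages Γ), SameHistory P.send (M.snk i) (T i) x y → x i = y i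

/-- In round `r`, the `l`-th symbol sent along the arc `d` is the `j`-th sub-packet of
session `i`. -/
def Carries (P : M.Protocol Γ) (d : M.G.Dart) (r : ℕ) (l : Fin (M.cap d.edge))
    (i : Fin M.k) (j : Fin (M.demand i)) : Prop :=
  ∀ x : M.Messages Γ, P.send d r x l = x i j

/-- Before round `r`, the node `u` holds the `j`-th sub-packet of session `i`: it originates at
`u`, or `u` received it in an earlier round. -/
def Holds (P : M.Protocol Γ) (u : M.V) (r : ℕ) (i : Fin M.k) (j : Fin (M.demand i)) : Prop :=
  M.src i = u ∨
    ∃ d : M.G.Dart, d.snd = u ∧ ∃ r' < r, ∃ l : Fin (M.cap d.edge), P.Carries d r' l i j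

/-- A routing protocol only forwards sub-packets: each symbol that a node sends is a sub-packet
that the node holds, or is idle (a constant, independent of all packets). -/
def IsRouting (P : M.Protocol Γ) : Prop :=
  ∀ (d : M.G.Dart) (r : ℕ) (l : Fin (M.cap d.edge)),
    (∃ a : Γ, ∀ x : M.Messages Γ, P.send d r x l = a) ∨
      ∃ (i : Fin M.k) (j : Fin (M.demand i)), P.Holds d.fst r i j ∧ P.Carries d r l i j

end Protocol

/-- The costs of the completion times of all network coding protocols. -/
def codingCosts (M : UnicastInstance) (Γ : Type) (cost : (Fin M.k → ℝ) → ℝ) : Set ℝ :=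
  {a | ∃ (P : M.Protocol Γ) (T : Fin M.k → ℕ),
    P.HasCompletionTimes T ∧ a = cost fun i => (T i : ℝ)}

/-- The costs of the completion times of all routing protocols. -/
def routingCosts (M : UnicastInstance) (Γ : Type) (cost : (Fin M.k → ℝ) → ℝ) : Set ℝ :=
  {a | ∃ (P : M.Protocol Γ) (T : Fin M.k → ℕ),
    P.IsRouting ∧ P.HasCompletionTimes T ∧ a = cost fun i => (T i : ℝ)}

/-- The network coding gap for a function `cost` of the completion times: the smallest cost of a
routing protocol divided by the smallest cost of a network coding protocol. -/
noncomputable def codingGap (M : UnicastInstance) (Γ : Type) (cost : (Fin M.k → ℝ) → ℝ) : ℝ :=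
  sInf (M.routingCosts Γ cost) / sInf (M.codingCosts Γ cost)

end UnicastInstance

/-- The `ℓ_p` norm of a vector: `(∑ i, |t i| ^ p) ^ (1 / p)` for `0 < p < ∞`, and
`max i, |t i|` for `p = ∞`. -/
noncomputable def lpCost {k : ℕ} (p : ℝ≥0∞) (t : Fin k → ℝ) : ℝ :=
  ‖WithLp.toLp p t‖

/-! One bottleneck shared by all sessions already gives the ratio 4/3. It carries the sum of all
packets, and each sink also hears the sum of the other packets, so coding takes 3 rounds. A packet
that avoids the bottleneck travels distance 4, and routing can push only a few packets through it.

The ratio is amplified by products. Keep two numbers for a network: `a`, the rounds of a code, and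
`b`, the distance from each source to its sink once the cut arcs are removed. In the product, every
ordinary arc of an outer copy becomes a session of an inner copy. Codes compose, so the `a`s
multiply (`HasCode.prod`). The `b`s multiply as well (`IsSeparated.prod`), provided that the
incidence graph of outer and inner copies has no short cycles: a short walk then lifts to a tree of
copies, where detours through other copies do not help. Such incidence graphs come from `SL₂` over
`ZMod P` (`girthAtLeast_unipotent`), with size polynomial when `b` is fixed.

`GapFamily` also records the ratio `r` of sessions to cut arcs and polynomial size bounds;
`GapFamily.square` shows that it survives squaring. After `i` squarings, `a = 3 ^ 2 ^ i` and `b = 4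
^ 2 ^ i`, while the logarithm of the number of sessions is at most exponential in `2 ^ i`. Hence the
ratio `b / a` is a power of that logarithm.

For an actual instance, only `4 * b * |F|` sessions can finish before round `2 * b` under routing
(`IsSeparated.card_le`). With `r = 8 * b` at least half of the sessions are late, which bounds every
`ℓ_p` cost at once (`le_codingGap`). -/

/-- The nodes of an oriented network with sessions `K`: each session has its own source and sink,
and there are further nodes `W`. -/
inductive Node (K W : Type) : Type
  | src (i : K) : Node K W
  | snk (i : K) : Node K W
  | relay (w : W) : Node K W

instance Node.instFinite {K W : Type} [Finite K] [Finite W] : Finite (Node K W) := by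
  let f : Node K W → K ⊕ K ⊕ W := fun v => match v with
    | .src i => .inl i
    | .snk i => .inr (.inl i)
    | .relay w => .inr (.inr w)
  refine Finite.of_injective f ?_
  rintro (i | i | i) (j | j | j) h <;> simp_all [f]

/-- An oriented network with sessions `K`, cut arcs `F` and ordinary arcs `A`. Each arc `e` is
meant to carry one symbol, in round `time e`. -/
structure OrientedNetwork (K W F A : Type) where
  tail : F ⊕ A → Node K W
  head : F ⊕ A → Node K W
  time : F ⊕ A → ℕ
  ne : ∀ e : A, tail (.inr e) ≠ head (.inr e)

namespace OrientedNetwork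

variable {K W F A : Type}

/-- If `σ e x` is the symbol on the arc `e`, then `x` and `y` look the same at `u` before
time `t`. -/
def Agree (N : OrientedNetwork K W F A) {Γ : Type} (σ : F ⊕ A → (K → Γ) → Γ) (u : Node K W)
    (t : ℕ) (x y : K → Γ) : Prop :=
  (∀ i, .src i = u → x i = y i) ∧ ∀ e, N.head e = u → N.time e < t → σ e x = σ e y

/-- Over every abelian group there is a code that delivers all packets within `a` rounds. -/
def HasCode (N : OrientedNetwork K W F A) (a : ℕ) : Prop :=
  (∀ e, N.time e < a) ∧ ∀ (Γ : Type) [AddCommGroup Γ], ∃ σ : F ⊕ A → (K → Γ) → Γ,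
    (∀ e x y, N.Agree σ (N.tail e) (N.time e) x y → σ e x = σ e y) ∧
      ∀ i x y, N.Agree σ (.snk i) a x y → x i = y i

/-- `φ` certifies that, without cut arcs, the sink of session `i` is at distance at least `b` from
its source. -/
structure IsPotential (N : OrientedNetwork K W F A) (b : ℕ) (i : K) (φ : Node K W → ℕ) : Prop where
  src : φ (.src i) = 0
  snk : φ (.snk i) = b
  le : ∀ v, φ v ≤ b
  head_le : ∀ e, φ (N.head (.inr e)) ≤ φ (N.tail (.inr e)) + 1
  tail_le : ∀ e, φ (N.tail (.inr e)) ≤ φ (N.head (.inr e)) + 1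

/-- Without cut arcs, each sink is at distance at least `b` from its source. -/
def IsSeparated (N : OrientedNetwork K W F A) (b : ℕ) : Prop :=
  ∀ i, ∃ φ, N.IsPotential b i φ

/-! ### Products of networks and of their codes -/

section Product

variable {K₁ W₁ F₁ A₁ K₂ W₂ F₂ A₂ Q : Type}

/-- The nodes of an outer copy as nodes of the product. -/
def outerNode {R : Type} (l : Q × K₂) : Node K₁ W₁ → Node ((Q × K₂) × K₁) ((Q × K₂) × W₁ ⊕ R)
  | .src i => .src (l, i)
  | .snk i => .snk (l, i)
  | .relay w => .relay (.inl (l, w))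

theorem outerNode_inj {R : Type} {l l' : Q × K₂} {a a' : Node K₁ W₁} :
    (outerNode l a : Node _ (_ ⊕ R)) = outerNode l' a' ↔ l = l' ∧ a = a' := by
  cases a <;> cases a' <;> simp [outerNode]

variable [Group Q] (u : A₁ → Q) (v : K₂ → Q)

/-- In the product, the outer copy attached to the port `j` of the inner copy `ρ`. -/
def outerAt (ρ : Q × A₁) (j : K₂) : Q × K₂ := (ρ.1 * u ρ.2 * v j * (u ρ.2)⁻¹ * (v j)⁻¹, j)

/-- In the product, the inner copy that replaces the arc `e` of the outer copy `l`. -/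
def innerAt (l : Q × K₂) (e : A₁) : Q × A₁ := (l.1 * v l.2 * u e * (v l.2)⁻¹ * (u e)⁻¹, e)

/-- The outer copy `(q, j)` and the inner copy `(q', e)` are attached exactly when `q * v j * u e =
q' * u e * v j`, a relation that can be solved for either side. Along a walk this telescopes into
alternating factors `(v j)⁻¹ * v j'` and `(u e)⁻¹ * u e'`. -/
theorem outerAt_innerAt (l : Q × K₂) (e : A₁) : outerAt u v (innerAt u v l e) l.2 = l := by
  ext <;> simp [outerAt, innerAt, mul_assoc]

theorem innerAt_outerAt (ρ : Q × A₁) (j : K₂) : innerAt u v (outerAt u v ρ j) ρ.2 = ρ := by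
  ext <;> simp [outerAt, innerAt, mul_assoc]

variable (N₁ : OrientedNetwork K₁ W₁ F₁ A₁) (N₂ : OrientedNetwork K₂ W₂ F₂ A₂)

/-- The nodes of an inner copy as nodes of the product: the terminals of a session are identified
with the end points of an arc of an outer copy. -/
def innerNode (ρ : Q × A₁) :
    Node K₂ W₂ → Node ((Q × K₂) × K₁) ((Q × K₂) × W₁ ⊕ (Q × A₁) × W₂)
  | .src j => outerNode (outerAt u v ρ j) (N₁.tail (.inr ρ.2))
  | .snk j => outerNode (outerAt u v ρ j) (N₁.head (.inr ρ.2))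
  | .relay w => .relay (.inr (ρ, w))

theorem innerNode_injective (ρ : Q × A₁) :
    Function.Injective (innerNode u v N₁ ρ : Node K₂ W₂ → _) := by
  have h := N₁.ne ρ.2
  have hj : ∀ j j' : K₂, outerAt u v ρ j = outerAt u v ρ j' → j = j' :=
    fun j j' h => congrArg Prod.snd h
  have hr : ∀ (l : Q × K₂) (a : Node K₁ W₁) (r : (Q × A₁) × W₂),
      outerNode l a ≠ .relay (.inr r) := by
    intro l a r; cases a <;> simp [outerNode]
  rintro (j | j | w) (j' | j' | w') hh <;>
    simp only [innerNode, outerNode_inj, Node.relay.injEq, Sum.inr.injEq, Prod.mk.injEq] at hh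
  · rw [hj _ _ hh.1]
  · exact absurd hh.2 h
  · exact absurd hh (hr _ _ _)
  · exact absurd hh.2.symm h
  · rw [hj _ _ hh.1]
  · exact absurd hh (hr _ _ _)
  · exact absurd hh.symm (hr _ _ _)
  · exact absurd hh.symm (hr _ _ _)
  · rw [hh.2]

/-- The product of two networks: copies of `N₁` in which the ordinary arcs are replaced by the
sessions of copies of `N₂`, each of which serves copies of one and the same arc of `N₁`; a round of
`N₁` takes `a` rounds. -/
def prod (a : ℕ) : OrientedNetwork ((Q × K₂) × K₁) ((Q × K₂) × W₁ ⊕ (Q × A₁) × W₂)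
    ((Q × K₂) × F₁ ⊕ (Q × A₁) × F₂) ((Q × A₁) × A₂) where
  tail e := match e with
    | .inl (.inl c) => outerNode c.1 (N₁.tail (.inl c.2))
    | .inl (.inr c) => innerNode u v N₁ c.1 (N₂.tail (.inl c.2))
    | .inr c => innerNode u v N₁ c.1 (N₂.tail (.inr c.2))
  head e := match e with
    | .inl (.inl c) => outerNode c.1 (N₁.head (.inl c.2))
    | .inl (.inr c) => innerNode u v N₁ c.1 (N₂.head (.inl c.2))
    | .inr c => innerNode u v N₁ c.1 (N₂.head (.inr c.2))
  time e := match e with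
    | .inl (.inl c) => N₁.time (.inl c.2) * a
    | .inl (.inr c) => N₁.time (.inr c.1.2) * a + N₂.time (.inl c.2)
    | .inr c => N₁.time (.inr c.1.2) * a + N₂.time (.inr c.2)
  ne c := fun h => N₂.ne c.2 (innerNode_injective u v N₁ c.1 h)

/-- The arcs of an inner copy as arcs of the product. -/
def innerArc (ρ : Q × A₁) : F₂ ⊕ A₂ → (((Q × K₂) × F₁ ⊕ (Q × A₁) × F₂) ⊕ (Q × A₁) × A₂)
  | .inl f => .inl (.inr (ρ, f))
  | .inr e => .inr (ρ, e)

theorem prod_head_innerArc (a : ℕ) (ρ : Q × A₁) (e : F₂ ⊕ A₂) :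
    (prod u v N₁ N₂ a).head (innerArc ρ e) = innerNode u v N₁ ρ (N₂.head e) := by
  cases e <;> rfl

theorem prod_time_innerArc (a : ℕ) (ρ : Q × A₁) (e : F₂ ⊕ A₂) :
    (prod u v N₁ N₂ a).time (innerArc ρ e) = N₁.time (.inr ρ.2) * a + N₂.time e := by
  cases e <;> rfl

/-- The code of the product. -/
def prodCode {Γ : Type} (σ₁ : F₁ ⊕ A₁ → (K₁ → Γ) → Γ) (σ₂ : F₂ ⊕ A₂ → (K₂ → Γ) → Γ) :
    (((Q × K₂) × F₁ ⊕ (Q × A₁) × F₂) ⊕ (Q × A₁) × A₂) → ((Q × K₂) × K₁ → Γ) → Γ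
  | .inl (.inl c), x => σ₁ (.inl c.2) fun i => x (c.1, i)
  | .inl (.inr c), x => σ₂ (.inl c.2) fun j => σ₁ (.inr c.1.2) fun i => x (outerAt u v c.1 j, i)
  | .inr c, x => σ₂ (.inr c.2) fun j => σ₁ (.inr c.1.2) fun i => x (outerAt u v c.1 j, i)

theorem prodCode_innerArc {Γ : Type} (σ₁ : F₁ ⊕ A₁ → (K₁ → Γ) → Γ) (σ₂ : F₂ ⊕ A₂ → (K₂ → Γ) → Γ)
    (ρ : Q × A₁) (e : F₂ ⊕ A₂) (x : (Q × K₂) × K₁ → Γ) :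
    prodCode u v σ₁ σ₂ (innerArc ρ e) x =
      σ₂ e fun j => σ₁ (.inr ρ.2) fun i => x (outerAt u v ρ j, i) := by
  cases e <;> rfl

variable {u v N₁ N₂}

/-- What a node of an outer copy knows in the product suffices for the outer code. -/
theorem Agree.outer {a : ℕ} (ha : 0 < a) (ht : ∀ e, N₂.time e < a) {Γ : Type}
    {σ₁ : F₁ ⊕ A₁ → (K₁ → Γ) → Γ} {σ₂ : F₂ ⊕ A₂ → (K₂ → Γ) → Γ}
    (hd : ∀ i x y, N₂.Agree σ₂ (.snk i) a x y → x i = y i) {l : Q × K₂} {c : Node K₁ W₁} {t : ℕ}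
    {x y : (Q × K₂) × K₁ → Γ}
    (h : (prod u v N₁ N₂ a).Agree (prodCode u v σ₁ σ₂) (outerNode l c) (t * a) x y) :
    N₁.Agree σ₁ c t (fun i => x (l, i)) fun i => y (l, i) := by
  refine ⟨?_, ?_⟩
  · rintro i rfl
    exact h.1 (l, i) rfl
  · rintro (e | e) rfl hlt
    · exact h.2 (.inl (.inl (l, e))) rfl
        (Nat.mul_lt_mul_of_pos_right hlt ha)
    -- The arc `e` is no longer present: its symbol is the packet of session `l.2` in the inner copy
    -- replacing it. That copy finishes by `(N₁.time e + 1) * a ≤ t * a`, so the inner decoder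
    -- recovers the symbol.
    · have key := hd l.2 (fun j => σ₁ (.inr e) fun i => x (outerAt u v (innerAt u v l e) j, i))
        (fun j => σ₁ (.inr e) fun i => y (outerAt u v (innerAt u v l e) j, i)) ⟨?_, ?_⟩
      · simpa only [outerAt_innerAt] using key
      · intro i hi; cases hi
      · intro ε hε _
        have := h.2 (innerArc (innerAt u v l e) ε) ?_ ?_
        · rw [prodCode_innerArc, prodCode_innerArc] at this
          exact this
        · rw [prod_head_innerArc, hε]
          exact outerNode_inj.2 ⟨outerAt_innerAt u v l e, rfl⟩
        · rw [prod_time_innerArc]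
          have := ht ε
          simp only [innerAt]
          nlinarith

theorem HasCode.prod {a₁ a₂ : ℕ} (h₁ : N₁.HasCode a₁) (h₂ : N₂.HasCode a₂) (ha : 0 < a₂) :
    (prod u v N₁ N₂ a₂).HasCode (a₁ * a₂) := by
  have hlt : ∀ {s r : ℕ}, s < a₁ → r < a₂ → s * a₂ + r < a₁ * a₂ := fun hs hr => by nlinarith
  have hin : ∀ (ρ : Q × A₁) (ε : F₂ ⊕ A₂),
      N₁.time (.inr ρ.2) * a₂ + N₂.time ε < a₁ * a₂ := fun ρ ε => hlt (h₁.1 _) (h₂.1 _)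
  refine ⟨?_, fun Γ _ => ?_⟩
  · rintro ((c | c) | c)
    · exact hlt (h₁.1 _) ha
    · exact hin c.1 _
    · exact hin c.1 _
  obtain ⟨σ₁, hc₁, hd₁⟩ := h₁.2 Γ
  obtain ⟨σ₂, hc₂, hd₂⟩ := h₂.2 Γ
  have inner : ∀ (ρ : Q × A₁) (ε : F₂ ⊕ A₂) (x y : (Q × K₂) × K₁ → Γ),
      (OrientedNetwork.prod u v N₁ N₂ a₂).Agree (prodCode u v σ₁ σ₂)
        (innerNode u v N₁ ρ (N₂.tail ε)) (N₁.time (.inr ρ.2) * a₂ + N₂.time ε) x y →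
      prodCode u v σ₁ σ₂ (innerArc ρ ε) x = prodCode u v σ₁ σ₂ (innerArc ρ ε) y := by
    intro ρ ε x y h
    rw [prodCode_innerArc, prodCode_innerArc]
    refine hc₂ ε _ _ ⟨?_, ?_⟩
    · intro j hj
      rw [← hj] at h
      -- The packet at the port `j` is an outer symbol, already computable at the start of the time
      -- slot of this inner copy, so the history is cut back to that moment.
      exact hc₁ _ _ _ (Agree.outer ha h₂.1 hd₂ (l := outerAt u v ρ j) (t := N₁.time (.inr ρ.2))
        ⟨h.1, fun e he het => h.2 e he (het.trans_le (Nat.le_add_right _ _))⟩)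
    · intro ε' hε' hlt'
      have := h.2 (innerArc ρ ε') (by rw [prod_head_innerArc, hε'])
        (by rw [prod_time_innerArc]; omega)
      rwa [prodCode_innerArc, prodCode_innerArc] at this
  refine ⟨prodCode u v σ₁ σ₂, ?_, ?_⟩
  · rintro ((c | c) | c) x y h
    · exact hc₁ _ _ _ (Agree.outer ha h₂.1 hd₂ (l := c.1) h)
    · exact inner c.1 (.inl c.2) x y h
    · exact inner c.1 (.inr c.2) x y h
  · intro i x y h
    exact hd₁ i.2 _ _ (Agree.outer ha h₂.1 hd₂ (l := i.1) (c := .snk i.2) h)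

end Product

end OrientedNetwork

/-! ### Distances in products, via the universal cover -/

namespace OrientedNetwork

section Reach

variable {K W F A : Type}

/-- `v` can be reached from `s` by a walk of length `n` along ordinary arcs, in any direction. -/
inductive Reach (N : OrientedNetwork K W F A) (s : Node K W) : ℕ → Node K W → Prop
  | refl : Reach N s 0 s
  | head {n : ℕ} (e : A) : Reach N s n (N.tail (.inr e)) → Reach N s (n + 1) (N.head (.inr e))
  | tail {n : ℕ} (e : A) : Reach N s n (N.head (.inr e)) → Reach N s (n + 1) (N.tail (.inr e))

theorem isSeparated_of_reach {N : OrientedNetwork K W F A} {b : ℕ}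
    (h : ∀ i n, N.Reach (.src i) n (.snk i) → b ≤ n) : N.IsSeparated b := by
  intro i
  -- The potential is the distance truncated at `b`; including `b` also keeps the infimum meaningful
  -- at unreachable nodes.
  let S : Node K W → Set ℕ := fun v => {n | n = b ∨ N.Reach (.src i) n v}
  have hS : ∀ v, (S v).Nonempty := fun v => ⟨b, .inl rfl⟩
  have hle : ∀ v, sInf (S v) ≤ b := fun v => Nat.sInf_le (.inl rfl)
  refine ⟨fun v => sInf (S v), ?_, ?_, hle, ?_, ?_⟩
  · exact Nat.le_zero.1 (Nat.sInf_le (.inr .refl))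
  · refine le_antisymm (hle _) (le_csInf (hS _) ?_)
    rintro n (rfl | hn)
    exacts [le_rfl, h i n hn]
  · intro e
    rcases Nat.sInf_mem (hS (N.tail (.inr e))) with h | h
    · exact (hle _).trans (by omega)
    · exact Nat.sInf_le (.inr (.head e h))
  · intro e
    rcases Nat.sInf_mem (hS (N.head (.inr e))) with h | h
    · exact (hle _).trans (by omega)
    · exact Nat.sInf_le (.inr (.tail e h))

end Reach

section Product

variable {K₁ W₁ F₁ A₁ K₂ W₂ F₂ A₂ Q : Type} [Group Q] (u : A₁ → Q) (v : K₂ → Q)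

/-- The outer copy reached from `l` by a word of moves; the move `(e, j)` enters the inner copy
that replaces the arc `e` and leaves it at its port `j`. -/
def position (l : Q × K₂) : List (A₁ × K₂) → Q × K₂
  | [] => l
  | p :: w => outerAt u v (innerAt u v (position l w) p.1) p.2

/-- The word `w` does not end with a move through `e`. -/
def Fresh (e : A₁) (w : List (A₁ × K₂)) : Prop := ∀ p ∈ w.head?, p.1 ≠ e

/-- The word has no backtracking. -/
def Reduced (l : Q × K₂) : List (A₁ × K₂) → Prop
  | [] => True
  | p :: w => Reduced l w ∧ p.2 ≠ (position u v l w).2 ∧ Fresh p.1 w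

/-- Words without backtracking of length less than `n` do not lead back. -/
def GirthAtLeast (n : ℕ) : Prop :=
  ∀ (l : Q × K₂) (w : List (A₁ × K₂)), Reduced u v l w → position u v l w = l → w.length < n →
    w = []

/-- The value at parameter `t` on the way from `α` to `β` at unit speed. -/
def interpolate (α β t : ℕ) : ℕ := α + min t (β - α) - min t (α - β)

variable (N₁ : OrientedNetwork K₁ W₁ F₁ A₁) (b : ℕ) (l : Q × K₂) (φ₁ : Node K₁ W₁ → ℕ)
  (φ₂ : K₂ → Node K₂ W₂ → ℕ)

open Classical in
/-- The potential on the outer copy at the end of a word in the universal cover of the product. -/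
noncomputable def outerPotential : List (A₁ × K₂) → Node K₁ W₁ → ℕ
  | [], c => b * φ₁ c
  | p :: w, c =>
    interpolate (outerPotential w (N₁.tail (.inr p.1))) (outerPotential w (N₁.head (.inr p.1)))
      (φ₂ (position u v l w).2 (if c = N₁.head (.inr p.1) then .snk p.2 else .src p.2))

/-- The potential on the inner copy that replaces the arc `e` of the outer copy at the end of a
word. -/
noncomputable def innerPotential (w : List (A₁ × K₂)) (e : A₁) (c : Node K₂ W₂) : ℕ :=
  interpolate (outerPotential u v N₁ b l φ₁ φ₂ w (N₁.tail (.inr e)))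
    (outerPotential u v N₁ b l φ₁ φ₂ w (N₁.head (.inr e))) (φ₂ (position u v l w).2 c)

variable {N₁ b l φ₁ φ₂} {N₂ : OrientedNetwork K₂ W₂ F₂ A₂}

/-- At the initial copy this is `φ₁` scaled by `b`. Each later copy only takes values between those
at the two ends of the arc through which it was entered, and these differ by at most `b`.
Interpolation at unit speed therefore reaches its target at parameter `b`. -/
theorem outerPotential_lipschitz
    (hφ₁ : ∀ e, φ₁ (N₁.head (.inr e)) ≤ φ₁ (N₁.tail (.inr e)) + 1 ∧
      φ₁ (N₁.tail (.inr e)) ≤ φ₁ (N₁.head (.inr e)) + 1) (w : List (A₁ × K₂)) (e : A₁) :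
    outerPotential u v N₁ b l φ₁ φ₂ w (N₁.head (.inr e)) ≤
        outerPotential u v N₁ b l φ₁ φ₂ w (N₁.tail (.inr e)) + b ∧
      outerPotential u v N₁ b l φ₁ φ₂ w (N₁.tail (.inr e)) ≤
        outerPotential u v N₁ b l φ₁ φ₂ w (N₁.head (.inr e)) + b := by
  induction w generalizing e with
  | nil =>
    have := hφ₁ e
    constructor <;> simp only [outerPotential] <;> nlinarith
  | cons p w ih =>
    have := ih p.1
    simp only [outerPotential, interpolate]
    split_ifs <;> omega

theorem innerPotential_src (hφ₂ : ∀ j, N₂.IsPotential b j (φ₂ j)) (w : List (A₁ × K₂)) (e : A₁) :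
    innerPotential u v N₁ b l φ₁ φ₂ w e (.src (position u v l w).2) =
      outerPotential u v N₁ b l φ₁ φ₂ w (N₁.tail (.inr e)) := by
  simp [innerPotential, interpolate, (hφ₂ _).src]

theorem innerPotential_snk (hφ₂ : ∀ j, N₂.IsPotential b j (φ₂ j))
    (hφ₁ : ∀ e, φ₁ (N₁.head (.inr e)) ≤ φ₁ (N₁.tail (.inr e)) + 1 ∧
      φ₁ (N₁.tail (.inr e)) ≤ φ₁ (N₁.head (.inr e)) + 1) (w : List (A₁ × K₂)) (e : A₁) :
    innerPotential u v N₁ b l φ₁ φ₂ w e (.snk (position u v l w).2) =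
      outerPotential u v N₁ b l φ₁ φ₂ w (N₁.head (.inr e)) := by
  have := outerPotential_lipschitz u v (φ₂ := φ₂) (b := b) (l := l) hφ₁ w e
  simp only [innerPotential, interpolate, (hφ₂ _).snk]
  omega

variable (N₁ b l φ₁ φ₂)

/-- The node `c` of the product is the image of a node of its universal cover with word length and
potential at most `n`. -/
def Lifts (n : ℕ) (c : Node ((Q × K₂) × K₁) ((Q × K₂) × W₁ ⊕ (Q × A₁) × W₂)) : Prop :=
  ∃ w, Reduced u v l w ∧ w.length ≤ n ∧
    ((∃ d, c = outerNode (position u v l w) d ∧ outerPotential u v N₁ b l φ₁ φ₂ w d ≤ n) ∨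
      ∃ e r, Fresh e w ∧ c = innerNode u v N₁ (innerAt u v (position u v l w) e) (.relay r) ∧
        innerPotential u v N₁ b l φ₁ φ₂ w e (.relay r) ≤ n)

variable {N₁ b l φ₁ φ₂}

/-- An arc can only be followed inside an inner copy, so a lift has to be seen there. A terminal has
two possible descriptions, as a node of the outer copy at `w` or as a port of an inner copy, and the
potentials agree. -/
theorem Lifts.exists_inner (hφ₂ : ∀ j, N₂.IsPotential b j (φ₂ j))
    (hφ₁ : ∀ e, φ₁ (N₁.head (.inr e)) ≤ φ₁ (N₁.tail (.inr e)) + 1 ∧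
      φ₁ (N₁.tail (.inr e)) ≤ φ₁ (N₁.head (.inr e)) + 1) {n : ℕ} {ρ : Q × A₁} {c : Node K₂ W₂}
    (h : Lifts u v N₁ b l φ₁ φ₂ n (innerNode u v N₁ ρ c)) :
    ∃ w e, Reduced u v l w ∧ w.length ≤ n ∧ Fresh e w ∧ ρ = innerAt u v (position u v l w) e ∧
      innerPotential u v N₁ b l φ₁ φ₂ w e c ≤ n := by
  obtain ⟨w, hw, hn, ⟨d, hc, hp⟩ | ⟨e, r, he, hc, hp⟩⟩ := h
  · have outer : ∀ j d', outerNode (outerAt u v ρ j) d' =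
        (outerNode (position u v l w) d : Node _ (_ ⊕ (Q × A₁) × W₂)) →
        (d' = N₁.tail (.inr ρ.2) ∧ c = .src j ∨ d' = N₁.head (.inr ρ.2) ∧ c = .snk j) →
        ∃ w e, Reduced u v l w ∧ w.length ≤ n ∧ Fresh e w ∧
          ρ = innerAt u v (position u v l w) e ∧
          innerPotential u v N₁ b l φ₁ φ₂ w e c ≤ n := by
      intro j d' hd hdc
      obtain ⟨hl, rfl⟩ := outerNode_inj.1 hd
      have hj : (position u v l w).2 = j := by rw [← hl]; rfl
      by_cases hf : Fresh ρ.2 w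
      · refine ⟨w, ρ.2, hw, hn, hf, ?_, ?_⟩
        · rw [← hl, innerAt_outerAt]
        · rcases hdc with ⟨rfl, rfl⟩ | ⟨rfl, rfl⟩
          · rwa [← hj, innerPotential_src u v hφ₂]
          · rwa [← hj, innerPotential_snk u v hφ₂ hφ₁]
      -- Here the inner copy is the one that the last move crossed, so it hangs at the word without
      -- that move.
      · match w, hf with
        | [], hf => exact absurd (by simp [Fresh]) hf
        | (e, j') :: w, hf =>
          obtain rfl : e = ρ.2 := by simpa [Fresh] using hf
          obtain rfl : j' = j := hj
          refine ⟨w, ρ.2, hw.1, (Nat.le_succ _).trans hn, hw.2.2, ?_, ?_⟩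
          · have h1 := innerAt_outerAt u v ρ j'
            have h2 := innerAt_outerAt u v (innerAt u v (position u v l w) ρ.2) j'
            rw [hl] at h1
            rw [← h1]
            exact h2
          · have hne := N₁.ne ρ.2
            rcases hdc with ⟨rfl, rfl⟩ | ⟨rfl, rfl⟩ <;>
              simpa only [outerPotential, innerPotential, if_neg hne, if_true] using hp
    cases c with
    | src j => exact outer j _ hc (.inl ⟨rfl, rfl⟩)
    | snk j => exact outer j _ hc (.inr ⟨rfl, rfl⟩)
    | relay r => cases d <;> simp [innerNode, outerNode] at hc
  · cases c with
    | relay r' =>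
      simp only [innerNode, Node.relay.injEq, Sum.inr.injEq, Prod.mk.injEq] at hc
      exact ⟨w, e, hw, hn, he, hc.1, hc.2 ▸ hp⟩
    | src j =>
      simp only [innerNode] at hc
      cases hh : N₁.tail (.inr ρ.2) <;> simp [hh, outerNode] at hc
    | snk j =>
      simp only [innerNode] at hc
      cases hh : N₁.head (.inr ρ.2) <;> simp [hh, outerNode] at hc

theorem Lifts.of_inner (hφ₂ : ∀ j, N₂.IsPotential b j (φ₂ j))
    (hφ₁ : ∀ e, φ₁ (N₁.head (.inr e)) ≤ φ₁ (N₁.tail (.inr e)) + 1 ∧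
      φ₁ (N₁.tail (.inr e)) ≤ φ₁ (N₁.head (.inr e)) + 1) {n : ℕ} {w : List (A₁ × K₂)} {e : A₁}
    {c : Node K₂ W₂} (hw : Reduced u v l w) (hn : w.length + 1 ≤ n) (he : Fresh e w)
    (hc : innerPotential u v N₁ b l φ₁ φ₂ w e c ≤ n) :
    Lifts u v N₁ b l φ₁ φ₂ n (innerNode u v N₁ (innerAt u v (position u v l w) e) c) := by
  cases c with
  | relay r => exact ⟨w, hw, by omega, .inr ⟨e, r, he, rfl, hc⟩⟩
  | src j =>
    -- The port of the current outer copy leaves the word unchanged; any other port leads to a new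
    -- copy and lengthens the word by `(e, j)`.
    by_cases hj : j = (position u v l w).2
    · subst hj
      refine ⟨w, hw, by omega, .inl ⟨_, ?_, (innerPotential_src u v hφ₂ w e) ▸ hc⟩⟩
      rw [innerNode, outerAt_innerAt]; rfl
    · refine ⟨(e, j) :: w, ⟨hw, hj, he⟩, hn, .inl ⟨N₁.tail (.inr e), rfl, ?_⟩⟩
      simpa only [outerPotential, innerPotential, if_neg (N₁.ne e)] using hc
  | snk j =>
    by_cases hj : j = (position u v l w).2
    · subst hj
      refine ⟨w, hw, by omega, .inl ⟨_, ?_, (innerPotential_snk u v hφ₂ hφ₁ w e) ▸ hc⟩⟩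
      rw [innerNode, outerAt_innerAt]; rfl
    · refine ⟨(e, j) :: w, ⟨hw, hj, he⟩, hn, .inl ⟨N₁.head (.inr e), rfl, ?_⟩⟩
      simpa only [outerPotential, innerPotential, if_true] using hc

theorem Lifts.step (hφ₂ : ∀ j, N₂.IsPotential b j (φ₂ j))
    (hφ₁ : ∀ e, φ₁ (N₁.head (.inr e)) ≤ φ₁ (N₁.tail (.inr e)) + 1 ∧
      φ₁ (N₁.tail (.inr e)) ≤ φ₁ (N₁.head (.inr e)) + 1) {n : ℕ} {ρ : Q × A₁} {c d : Node K₂ W₂}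
    (hcd : ∀ j, φ₂ j d ≤ φ₂ j c + 1 ∧ φ₂ j c ≤ φ₂ j d + 1)
    (h : Lifts u v N₁ b l φ₁ φ₂ n (innerNode u v N₁ ρ c)) :
    Lifts u v N₁ b l φ₁ φ₂ (n + 1) (innerNode u v N₁ ρ d) := by
  obtain ⟨w, e, hw, hn, he, rfl, hc⟩ := Lifts.exists_inner u v hφ₂ hφ₁ h
  refine Lifts.of_inner u v hφ₂ hφ₁ hw (by omega) he ?_
  have := hcd (position u v l w).2
  simp only [innerPotential, interpolate] at hc ⊢
  omega

variable {u v}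

/-- Each step of a walk raises both the word length and the potential of its lift by at most one. A
walk shorter than `b₁ * b` to the sink thus ends at a short closed word, which is empty by the girth
condition, and in the initial copy the sink has potential `b * b₁`. -/
theorem IsSeparated.prod {b₁ : ℕ} {N₁ : OrientedNetwork K₁ W₁ F₁ A₁} (h₁ : N₁.IsSeparated b₁)
    (h₂ : N₂.IsSeparated b) (hg : GirthAtLeast u v (b₁ * b)) (a : ℕ) :
    (prod u v N₁ N₂ a).IsSeparated (b₁ * b) := by
  refine isSeparated_of_reach fun ⟨l, i⟩ n hn => ?_
  obtain ⟨φ₁, hφ₁⟩ := h₁ i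
  choose φ₂ hφ₂ using h₂
  have hφ₁' : ∀ e, φ₁ (N₁.head (.inr e)) ≤ φ₁ (N₁.tail (.inr e)) + 1 ∧
      φ₁ (N₁.tail (.inr e)) ≤ φ₁ (N₁.head (.inr e)) + 1 :=
    fun e => ⟨hφ₁.head_le e, hφ₁.tail_le e⟩
  have key : ∀ n c, (OrientedNetwork.prod u v N₁ N₂ a).Reach (.src (l, i)) n c →
      Lifts u v N₁ b l φ₁ φ₂ n c := by
    intro n c h
    induction h with
    | refl =>
      refine ⟨[], trivial, le_rfl, .inl ⟨.src i, rfl, ?_⟩⟩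
      simp [outerPotential, hφ₁.src]
    | head e _ ih =>
      exact Lifts.step u v hφ₂ hφ₁'
        (fun j => ⟨(hφ₂ j).head_le e.2, (hφ₂ j).tail_le e.2⟩) ih
    | tail e _ ih =>
      exact Lifts.step u v hφ₂ hφ₁'
        (fun j => ⟨(hφ₂ j).tail_le e.2, (hφ₂ j).head_le e.2⟩) ih
  by_contra! hlt
  obtain ⟨w, hw, hwn, ⟨d, hc, hp⟩ | ⟨e, r, he, hc, hp⟩⟩ := key n _ hn
  · obtain ⟨hl, rfl⟩ := outerNode_inj.1 (show outerNode l (.snk i) = _ from hc)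
    obtain rfl := hg l w hw hl.symm (by omega)
    rw [outerPotential, hφ₁.snk, mul_comm] at hp
    omega
  · cases hc

end Product

end OrientedNetwork

/-! ### Large girth from unipotent matrices -/

namespace OrientedNetwork

open Matrix

variable {P : ℕ}

/-- The upper unipotent matrix with entry `t`. -/
def upperUnipotent (t : ZMod P) : SpecialLinearGroup (Fin 2) (ZMod P) :=
  ⟨!![1, t; 0, 1], by simp [det_fin_two]⟩

/-- The lower unipotent matrix with entry `t`. -/
def lowerUnipotent (t : ZMod P) : SpecialLinearGroup (Fin 2) (ZMod P) :=
  ⟨!![1, 0; t, 1], by simp [det_fin_two]⟩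

theorem coe_upperUnipotent (t : ZMod P) :
    (upperUnipotent t : Matrix (Fin 2) (Fin 2) (ZMod P)) = !![1, t; 0, 1] := rfl

theorem coe_lowerUnipotent (t : ZMod P) :
    (lowerUnipotent t : Matrix (Fin 2) (Fin 2) (ZMod P)) = !![1, 0; t, 1] := rfl

theorem upperUnipotent_inv_mul (s t : ZMod P) :
    (upperUnipotent s)⁻¹ * upperUnipotent t = upperUnipotent (t - s) := by
  rw [inv_mul_eq_iff_eq_mul]
  ext i j
  fin_cases i <;> fin_cases j <;> simp [coe_upperUnipotent, mul_apply, Fin.sum_univ_two]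

theorem lowerUnipotent_inv_mul (s t : ZMod P) :
    (lowerUnipotent s)⁻¹ * lowerUnipotent t = lowerUnipotent (t - s) := by
  rw [inv_mul_eq_iff_eq_mul]
  ext i j
  fin_cases i <;> fin_cases j <;> simp [coe_lowerUnipotent, mul_apply, Fin.sum_univ_two]

theorem mul_upperUnipotent_apply (g : SpecialLinearGroup (Fin 2) (ZMod P)) (t : ZMod P) :
    (g * upperUnipotent t) 1 0 = g 1 0 ∧ (g * upperUnipotent t) 1 1 = g 1 1 + g 1 0 * t := by
  constructor <;> simp [coe_upperUnipotent, mul_apply, Fin.sum_univ_two, add_comm]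

theorem mul_lowerUnipotent_apply (g : SpecialLinearGroup (Fin 2) (ZMod P)) (t : ZMod P) :
    (g * lowerUnipotent t) 1 0 = g 1 0 + g 1 1 * t ∧ (g * lowerUnipotent t) 1 1 = g 1 1 := by
  constructor <;> simp [coe_lowerUnipotent, mul_apply, Fin.sum_univ_two]

theorem abs_add_mul_two_mul {c d s : ℤ} {D : ℕ} (hcd : |c| < |d|) (hs : s ≠ 0) (hD : |s| ≤ D) :
    |d| < |c + d * (2 * s)| ∧ |c + d * (2 * s)| ≤ (2 * D + 1) * |d| := by
  have h1 : 1 ≤ |s| := Int.one_le_abs hs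
  have h2 : |d * (2 * s)| = 2 * (|d| * |s|) := by
    rw [abs_mul, abs_mul, abs_two]; ring
  have h3 : |d| * 1 ≤ |d| * |s| := mul_le_mul_of_nonneg_left h1 (abs_nonneg d)
  have h4 : |d| * |s| ≤ |d| * D := mul_le_mul_of_nonneg_left hD (abs_nonneg d)
  have h5 := abs_add_le c (d * (2 * s))
  have h6 := abs_sub_abs_le_abs_sub (d * (2 * s)) (-c)
  rw [abs_neg, sub_neg_eq_add, add_comm (d * (2 * s)) c] at h6
  constructor <;> linarith

variable {A₁ K₂ : Type} (x : A₁ → ℤ) (y : K₂ → ℤ)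

/-- A ping-pong argument on the bottom row `(c, d)`, lifted to the integers. Even nonzero shears
keep `|c| < |d|` after each full move, while each shear multiplies the larger entry by at most `2 *
D + 1`. So the entry that a closed word would annihilate modulo `P` is nonzero and smaller than `P`.
-/
theorem girthAtLeast_unipotent {D n : ℕ} (hx : Function.Injective x) (hy : Function.Injective y)
    (hxD : ∀ e e', |x e - x e'| ≤ D) (hyD : ∀ j j', |y j - y j'| ≤ D)
    (hP : (2 * D + 1) ^ (2 * n) < P) :
    GirthAtLeast (fun e => upperUnipotent (P := P) (2 * x e : ℤ))
      (fun j => lowerUnipotent (P := P) (2 * y j : ℤ)) n := by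
  set u : A₁ → SpecialLinearGroup (Fin 2) (ZMod P) := fun e => upperUnipotent (2 * x e : ℤ)
  set v : K₂ → SpecialLinearGroup (Fin 2) (ZMod P) := fun j => lowerUnipotent (2 * y j : ℤ)
  intro l
  let g : List (A₁ × K₂) → A₁ → SpecialLinearGroup (Fin 2) (ZMod P) := fun w e =>
    (v l.2)⁻¹ * l.1⁻¹ * (position u v l w).1 * v (position u v l w).2 * u e
  have hu : ∀ e e', (u e)⁻¹ * u e' = upperUnipotent ((2 * (x e' - x e) : ℤ) : ZMod P) := by
    intro e e'
    simp only [u, upperUnipotent_inv_mul]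
    congr 1; push_cast; ring
  have hv : ∀ j j', (v j)⁻¹ * v j' = lowerUnipotent ((2 * (y j' - y j) : ℤ) : ZMod P) := by
    intro j j'
    simp only [v, lowerUnipotent_inv_mul]
    congr 1; push_cast; ring
  have g_cons : ∀ p w e, g (p :: w) e =
      g w p.1 * ((v (position u v l w).2)⁻¹ * v p.2) * ((u p.1)⁻¹ * u e) := by
    intro p w e
    simp only [g, position, outerAt, innerAt]
    group
  have row : ∀ w, Reduced u v l w → ∀ e, Fresh e w → ∃ c d : ℤ, g w e 1 0 = (c : ZMod P) ∧
      g w e 1 1 = (d : ZMod P) ∧ |c| < |d| ∧ |d| ≤ (2 * D + 1) ^ (2 * w.length) := by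
    intro w
    induction w with
    | nil =>
      intro _ e _
      have : g [] e = u e := by simp [g, position]
      refine ⟨0, 1, ?_, ?_, by simp, by simp⟩ <;> simp [this, u, coe_upperUnipotent]
    | cons p w ih =>
      rintro ⟨hw, hj, he⟩ e hfe
      obtain ⟨c, d, hc, hd, hcd, hdle⟩ := ih hw p.1 he
      have hne : p.1 ≠ e := hfe p (by simp)
      obtain ⟨h1, h2⟩ := abs_add_mul_two_mul hcd (sub_ne_zero.2 (hy.ne hj)) (hyD _ _)
      obtain ⟨h3, h4⟩ := abs_add_mul_two_mul h1 (sub_ne_zero.2 (hx.ne hne.symm)) (hxD _ _)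
      refine ⟨_, _, ?_, ?_, h3, ?_⟩
      · rw [g_cons, hu, hv, (mul_upperUnipotent_apply _ _).1, (mul_lowerUnipotent_apply _ _).1,
          hc, hd]
        push_cast; ring
      · rw [g_cons, hu, hv, (mul_upperUnipotent_apply _ _).2, (mul_lowerUnipotent_apply _ _).1,
          (mul_lowerUnipotent_apply _ _).2, hc, hd]
        push_cast; ring
      · have hpos : (0 : ℤ) ≤ 2 * D + 1 := by positivity
        calc _ ≤ (2 * D + 1) * ((2 * D + 1) * (2 * D + 1 : ℤ) ^ (2 * w.length)) :=
              h4.trans (mul_le_mul_of_nonneg_left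
                (h2.trans (mul_le_mul_of_nonneg_left hdle hpos)) hpos)
          _ = _ := by simp only [List.length_cons]; ring
  intro w hw hl hn
  match w, hw with
  | [], _ => rfl
  | p :: w, ⟨hw, hj, he⟩ =>
    exfalso
    obtain ⟨c, d, hc, hd, hcd, hdle⟩ := row w hw p.1 he
    obtain ⟨h1, h2⟩ := abs_add_mul_two_mul hcd (sub_ne_zero.2 (hy.ne hj)) (hyD _ _)
    -- Evaluating at `p.1` cancels the final upper factor, leaving `c + d * (2 * s)` as the bottom
    -- left entry, which has to vanish.
    have h3 : g (p :: w) p.1 = u p.1 := by simp [g, hl]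
    rw [g_cons, inv_mul_cancel, mul_one, hv] at h3
    have h4 := (mul_lowerUnipotent_apply (g w p.1)
      ((2 * (y p.2 - y (position u v l w).2) : ℤ) : ZMod P)).1
    rw [h3, hc, hd] at h4
    have h5 : ((c + d * (2 * (y p.2 - y (position u v l w).2)) : ℤ) : ZMod P) = 0 := by
      rw [← Int.cast_mul, ← Int.cast_add] at h4
      rw [← h4]; simp [u, coe_upperUnipotent]
    rw [ZMod.intCast_zmod_eq_zero_iff_dvd] at h5
    have h6 := Int.le_of_dvd ((abs_nonneg d).trans_lt h1) ((dvd_abs _ _).2 h5)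
    have hle : (2 * D + 1 : ℤ) ^ (2 * w.length + 1) ≤ (2 * D + 1) ^ (2 * n) :=
      pow_le_pow_right₀ (by linarith [Int.natCast_nonneg D])
        (by simp only [List.length_cons] at hn; omega)
    have hP' : ((2 * D + 1 : ℤ)) ^ (2 * n) < P := by exact_mod_cast hP
    have h7 := mul_le_mul_of_nonneg_left hdle (show (0 : ℤ) ≤ 2 * D + 1 by positivity)
    rw [← pow_succ'] at h7
    linarith

end OrientedNetwork

/-! ### The bottleneck network and repeated squaring -/

namespace OrientedNetwork

/-- The nodes `false` and `true` are the end points of the bottleneck, all packets are sent to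
`false`, `true` is connected to all sinks, and the relay `i` forwards to the sink of session `i`
what it hears from the sources of all other sessions. -/
def bottleneck (k : ℕ) : OrientedNetwork (Fin k) (Bool ⊕ Fin k) Unit
    (Fin k ⊕ Fin k ⊕ Fin k ⊕ {p : Fin k × Fin k // p.1 ≠ p.2}) where
  tail
    | .inl _ => .relay (.inl false)
    | .inr (.inl i) => .src i
    | .inr (.inr (.inl _)) => .relay (.inl true)
    | .inr (.inr (.inr (.inl i))) => .relay (.inr i)
    | .inr (.inr (.inr (.inr p))) => .src p.1.1
  head
    | .inl _ => .relay (.inl true)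
    | .inr (.inl _) => .relay (.inl false)
    | .inr (.inr (.inl i)) => .snk i
    | .inr (.inr (.inr (.inl i))) => .snk i
    | .inr (.inr (.inr (.inr p))) => .relay (.inr p.1.2)
  time
    | .inl _ => 1
    | .inr (.inl _) => 0
    | .inr (.inr (.inl _)) => 2
    | .inr (.inr (.inr (.inl _))) => 1
    | .inr (.inr (.inr (.inr _))) => 0
  ne e := by rcases e with _ | _ | _ | _ <;> simp

theorem bottleneck_hasCode (k : ℕ) : (bottleneck k).HasCode 3 := by
  refine ⟨by rintro (_ | _ | _ | _ | _) <;> simp [bottleneck], fun Γ _ => ?_⟩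
  refine ⟨fun e x => match e with
    | .inl _ => ∑ j, x j
    | .inr (.inl i) => x i
    | .inr (.inr (.inl _)) => ∑ j, x j
    | .inr (.inr (.inr (.inl i))) => ∑ j ∈ Finset.univ.erase i, x j
    | .inr (.inr (.inr (.inr p))) => x p.1.1, ?_, ?_⟩
  · rintro (_ | i | i | i | p) x y ⟨h₁, h₂⟩
    · exact Finset.sum_congr rfl fun j _ => h₂ (.inr (.inl j)) rfl (by simp [bottleneck])
    · exact h₁ i rfl
    · exact h₂ (.inl ()) rfl (by simp [bottleneck])
    · exact Finset.sum_congr rfl fun j hj =>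
        h₂ (.inr (.inr (.inr (.inr ⟨(j, i), Finset.ne_of_mem_erase hj⟩)))) rfl
          (by simp [bottleneck])
    · exact h₁ p.1.1 rfl
  · rintro i x y ⟨-, h⟩
    have h₁ := h (.inr (.inr (.inl i))) rfl (by simp [bottleneck])
    have h₂ := h (.inr (.inr (.inr (.inl i)))) rfl (by simp [bottleneck])
    simp only at h₁ h₂
    rw [← Finset.add_sum_erase _ x (Finset.mem_univ i),
      ← Finset.add_sum_erase _ y (Finset.mem_univ i), h₂] at h₁
    exact add_right_cancel h₁

theorem bottleneck_isSeparated (k : ℕ) : (bottleneck k).IsSeparated 4 := by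
  intro i
  refine ⟨fun c => match c with
    | .src j => if j = i then 0 else 2
    | .snk j => if j = i then 4 else 2
    | .relay (.inl false) => 1
    | .relay (.inl true) => 3
    | .relay (.inr j) => if j = i then 3 else 1, ?_, ?_, ?_, ?_, ?_⟩
  · simp
  · simp
  · rintro (j | j | (_ | _) | j) <;> simp only <;> (try split_ifs) <;> omega
  · rintro (j | j | j | ⟨⟨j, j'⟩, hj⟩) <;> simp only [bottleneck] <;> split_ifs <;> simp_all
  · rintro (j | j | j | ⟨⟨j, j'⟩, hj⟩) <;> simp only [bottleneck] <;> split_ifs <;> simp_all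

/-- For every `r` there is a network with `r` times as many sessions as cut arcs that has a code
with `a` rounds although its sinks have distance `b` from their sources without cut arcs; its size
is polynomial in `r`. -/
def GapFamily (a b e s : ℕ) : Prop :=
  ∀ r, 2 ≤ r → ∃ (K W F A : Type) (_ : Finite K) (_ : Finite W) (_ : Finite F) (_ : Finite A)
    (N : OrientedNetwork K W F A), N.HasCode a ∧ N.IsSeparated b ∧ 0 < Nat.card F ∧
      r * Nat.card F ≤ Nat.card K ∧ Nat.card A ≤ r ^ e * Nat.card F ∧
      Nat.card K ≤ r ^ s ∧ Nat.card A ≤ r ^ s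

theorem GapFamily.mono {a b e s s' : ℕ} (h : GapFamily a b e s) (hs : s ≤ s') :
    GapFamily a b e s' := by
  intro r hr
  obtain ⟨K, W, F, A, i1, i2, i3, i4, N, h1, h2, h3, h4, h5, h6, h7⟩ := h r hr
  have := Nat.pow_le_pow_right (by omega : 0 < r) hs
  exact ⟨K, W, F, A, i1, i2, i3, i4, N, h1, h2, h3, h4, h5, h6.trans this, h7.trans this⟩

theorem gapFamily_bottleneck : GapFamily 3 4 4 4 := by
  intro r hr
  have hA : Nat.card (Fin r ⊕ Fin r ⊕ Fin r ⊕ {p : Fin r × Fin r // p.1 ≠ p.2}) ≤ r ^ 4 := by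
    have h1 : Nat.card {p : Fin r × Fin r // p.1 ≠ p.2} ≤ r * r :=
      (Finite.card_subtype_le _).trans (by simp)
    simp only [Nat.card_sum, Nat.card_fin]
    have h2 : r * 2 ≤ r * r := Nat.mul_le_mul_left r hr
    have h3 : r * r * 4 ≤ r * r * (r * r) := Nat.mul_le_mul_left _ (by nlinarith)
    have h4 : r ^ 4 = r * r * (r * r) := by ring
    omega
  refine ⟨_, _, _, _, inferInstance, inferInstance, inferInstance, inferInstance, bottleneck r,
    bottleneck_hasCode r, bottleneck_isSeparated r, by simp, by simp, by simpa using hA, ?_, hA⟩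
  rw [Nat.card_fin]
  exact Nat.le_self_pow (by norm_num) r

theorem card_specialLinearGroup_le (n : ℕ) [NeZero n] :
    Nat.card (Matrix.SpecialLinearGroup (Fin 2) (ZMod n)) ≤ n ^ 4 := by
  refine (Finite.card_subtype_le _).trans (le_of_eq ?_)
  unfold Matrix
  rw [Nat.card_fun, Nat.card_fun, Nat.card_zmod, Nat.card_fin, ← pow_mul]

theorem exists_girthAtLeast {A K : Type} [Finite A] [Finite K] {D : ℕ} (n : ℕ)
    (hA : Nat.card A ≤ D) (hK : Nat.card K ≤ D) :
    ∃ (Q : Type) (_ : Group Q) (_ : Finite Q) (u : A → Q) (v : K → Q), GirthAtLeast u v n ∧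
      Nat.card Q ≤ ((2 * D + 1) ^ (2 * n) + 1) ^ 4 := by
  have key : ∀ (B : Type) [Finite B], Nat.card B ≤ D →
      ∃ x : B → ℤ, Function.Injective x ∧ ∀ e e', |x e - x e'| ≤ D := by
    intro B _ hB
    refine ⟨fun e => (Finite.equivFin B e : ℕ), fun e e' h => ?_, fun e e' => ?_⟩
    · exact (Finite.equivFin B).injective (Fin.ext (Int.ofNat.inj h))
    · have h1 := (Finite.equivFin B e).2
      have h2 := (Finite.equivFin B e').2
      simp only [abs_le]
      constructor <;> omega
  obtain ⟨x, hx, hxD⟩ := key A hA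
  obtain ⟨y, hy, hyD⟩ := key K hK
  exact ⟨_, inferInstance, inferInstance, _, _,
    girthAtLeast_unipotent x y hx hy hxD hyD (Nat.lt_succ_self _), card_specialLinearGroup_le _⟩

/-- The outer factor has ratio `2 * r`, the inner one `(2 * r) ^ e`. Outer arcs outnumber outer cut
arcs by at most `(2 * r) ^ e`, so the cut arcs of inner copies are at most as many as those of outer
copies. The resulting factor 2 turns `2 * r` into `r`. -/
theorem GapFamily.square {a b e s : ℕ} (ha : 0 < a) (hb : 0 < b) (he : 0 < e) (hs : 0 < s)
    (h : GapFamily a b e s) :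
    GapFamily (a * a) (b * b) (2 * e ^ 2) (40 * e * s * (b * b)) := by
  intro r hr
  have hr0 : 0 < r := by omega
  have hrr : 2 * r ≤ r ^ 2 := by nlinarith
  obtain ⟨K₁, W₁, F₁, A₁, _, _, _, _, N₁, hc₁, hp₁, hf₁, hk₁, hm₁, hks₁, hms₁⟩ :=
    h (2 * r) (by omega)
  obtain ⟨K₂, W₂, F₂, A₂, _, _, _, _, N₂, hc₂, hp₂, hf₂, hk₂, hm₂, hks₂, hms₂⟩ :=
    h ((2 * r) ^ e) ((by omega : 2 ≤ 2 * r).trans (Nat.le_self_pow he.ne' _))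
  set X := r ^ (2 * (e * s)) with hX
  have hX1 : ∀ c ≤ (2 * r) ^ s, c ≤ X := fun c hc => by
    refine hc.trans ((Nat.pow_le_pow_left hrr s).trans ?_)
    rw [← pow_mul]
    exact Nat.pow_le_pow_right hr0 (by nlinarith)
  have hX2 : ∀ c ≤ ((2 * r) ^ e) ^ s, c ≤ X := fun c hc => by
    refine hc.trans ?_
    rw [← pow_mul, hX, pow_mul r]
    exact Nat.pow_le_pow_left hrr _
  obtain ⟨Q, _, _, u, v, hg, hQ⟩ := exists_girthAtLeast (b * b) (hX1 _ hms₁) (hX2 _ hks₂)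
  have hX0 : 0 < X := pow_pos hr0 _
  have hQ' : Nat.card Q ≤ r ^ (4 * ((2 * (e * s) + 2) * (2 * (b * b)) + 1)) := by
    have h1 : 2 * X + 1 ≤ r ^ (2 * (e * s) + 2) := by
      rw [pow_add, ← hX]
      nlinarith
    have h2 := Nat.pow_le_pow_left h1 (2 * (b * b))
    rw [← pow_mul] at h2
    have h3 : (2 * X + 1) ^ (2 * (b * b)) + 1 ≤ r ^ ((2 * (e * s) + 2) * (2 * (b * b)) + 1) := by
      rw [pow_succ]
      have : 0 < r ^ ((2 * (e * s) + 2) * (2 * (b * b))) := pow_pos hr0 _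
      nlinarith
    refine hQ.trans ((Nat.pow_le_pow_left h3 4).trans (le_of_eq ?_))
    rw [← pow_mul, mul_comm]
  have hsize : ∀ c d, c ≤ X → d ≤ X →
      Nat.card Q * c * d ≤ r ^ (40 * e * s * (b * b)) := by
    intro c d hc hd
    refine (Nat.mul_le_mul (Nat.mul_le_mul hQ' hc) hd).trans ?_
    rw [hX, ← pow_add, ← pow_add]
    refine Nat.pow_le_pow_right hr0 ?_
    have h1 : 0 < e * s := by positivity
    have h2 : 0 < b * b := by positivity
    have h3 : b * b ≤ e * s * (b * b) := Nat.le_mul_of_pos_left _ h1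
    have h4 : e * s ≤ e * s * (b * b) := Nat.le_mul_of_pos_right _ h2
    have h5 : 1 ≤ e * s * (b * b) := Nat.mul_pos h1 h2
    have h6 : 40 * e * s * (b * b) = 40 * (e * s * (b * b)) := by ring
    rw [h6]
    nlinarith
  have hq : 0 < Nat.card Q := Nat.card_pos
  have hk₂0 : 0 < Nat.card K₂ := (Nat.mul_pos (by positivity) hf₂).trans_le hk₂
  refine ⟨_, _, _, _, inferInstance, inferInstance, inferInstance, inferInstance,
    prod u v N₁ N₂ a, hc₁.prod hc₂ ha, hp₁.prod hp₂ hg a, ?_, ?_, ?_, ?_, ?_⟩ <;>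
    simp only [Nat.card_sum, Nat.card_prod]
  · positivity
  · have h1 : Nat.card A₁ * Nat.card F₂ ≤ Nat.card K₂ * Nat.card F₁ := by
      calc _ ≤ (2 * r) ^ e * Nat.card F₁ * Nat.card F₂ := Nat.mul_le_mul_right _ hm₁
        _ = (2 * r) ^ e * Nat.card F₂ * Nat.card F₁ := by ring
        _ ≤ _ := Nat.mul_le_mul_right _ hk₂
    calc r * (Nat.card Q * Nat.card K₂ * Nat.card F₁ + Nat.card Q * Nat.card A₁ * Nat.card F₂)
        = r * Nat.card Q * (Nat.card K₂ * Nat.card F₁ + Nat.card A₁ * Nat.card F₂) := by ring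
      _ ≤ r * Nat.card Q * (Nat.card K₂ * Nat.card F₁ + Nat.card K₂ * Nat.card F₁) :=
          Nat.mul_le_mul_left _ (Nat.add_le_add_left h1 _)
      _ = Nat.card Q * Nat.card K₂ * (2 * r * Nat.card F₁) := by ring
      _ ≤ _ := Nat.mul_le_mul_left _ hk₁
  · have h1 : ((2 * r) ^ e) ^ e ≤ r ^ (2 * e ^ 2) := by
      rw [← pow_mul, pow_mul r, ← sq]
      exact Nat.pow_le_pow_left hrr _
    calc Nat.card Q * Nat.card A₁ * Nat.card A₂
        ≤ Nat.card Q * Nat.card A₁ * (r ^ (2 * e ^ 2) * Nat.card F₂) :=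
          Nat.mul_le_mul_left _ (hm₂.trans (Nat.mul_le_mul_right _ h1))
      _ = r ^ (2 * e ^ 2) * (Nat.card Q * Nat.card A₁ * Nat.card F₂) := by ring
      _ ≤ _ := Nat.mul_le_mul_left _ (Nat.le_add_left _ _)
  · exact hsize _ _ (hX2 _ hks₂) (hX1 _ hks₁)
  · exact hsize _ _ (hX1 _ hms₁) (hX2 _ hms₂)

theorem exists_gapFamily (i : ℕ) : ∃ e, 2 * e = 8 ^ 2 ^ i ∧
    GapFamily (3 ^ 2 ^ i) (4 ^ 2 ^ i) e (5120 ^ 2 ^ i) := by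
  induction i with
  | zero => exact ⟨4, by norm_num, gapFamily_bottleneck.mono (by norm_num)⟩
  | succ i ih =>
    obtain ⟨e, he, h⟩ := ih
    have he0 : 0 < e := by
      have : 0 < 8 ^ 2 ^ i := by positivity
      omega
    refine ⟨2 * e ^ 2, ?_, ?_⟩
    · rw [pow_succ 2 i, pow_mul, ← he]; ring
    · have hsq : ∀ c : ℕ, c ^ 2 ^ (i + 1) = c ^ 2 ^ i * c ^ 2 ^ i := fun c => by
        rw [pow_succ 2 i, pow_mul, sq]
      have h' := h.square (by positivity) (by positivity) he0 (by positivity)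
      rw [← hsq, ← hsq] at h'
      refine h'.mono ?_
      rw [hsq 5120, hsq 4]
      have h1 : e ≤ 8 ^ 2 ^ i := by omega
      have h2 : 40 ≤ 40 ^ 2 ^ i := Nat.le_self_pow (by positivity) _
      -- The base is chosen so that `5120 = 40 * 8 * 4 * 4` absorbs all new factors.
      calc 40 * e * 5120 ^ 2 ^ i * (4 ^ 2 ^ i * 4 ^ 2 ^ i)
          ≤ 40 ^ 2 ^ i * 8 ^ 2 ^ i * 5120 ^ 2 ^ i * (4 ^ 2 ^ i * 4 ^ 2 ^ i) := by gcongr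
        _ = (40 * 8 * 4 * 4) ^ 2 ^ i * 5120 ^ 2 ^ i := by simp only [mul_pow]; ring
        _ = _ := by norm_num

end OrientedNetwork

/-! ### Existence of routing protocols and the movement of packets -/

namespace UnicastInstance

variable {M : UnicastInstance} {Γ : Type}

theorem exists_adj_dist_le {V : Type} {G : SimpleGraph V} (hG : G.Connected) {s u : V} {n : ℕ}
    (h : G.dist s u = n + 1) : ∃ w, G.Adj w u ∧ G.dist s w ≤ n := by
  obtain ⟨p, hp⟩ := (hG u s).exists_walk_length_eq_dist
  rw [SimpleGraph.dist_comm, h] at hp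
  cases p with
  | nil => simp at hp
  | cons hadj p =>
    refine ⟨_, hadj.symm, ?_⟩
    rw [SimpleGraph.dist_comm]
    exact (SimpleGraph.dist_le p).trans (by simpa using hp.le)

open Classical in
/-- In round `Nat.pair c t` the packet number `c` is sent by all nodes at distance at most `t` from
its source. -/
noncomputable def flooding (M : UnicastInstance) (a : Γ) : M.Protocol Γ where
  send d r x _ := match (Encodable.decode r.unpair.1 : Option (Σ i, Fin (M.demand i))) with
    | some s => if M.G.dist (M.src s.1) d.fst ≤ r.unpair.2 then x s.1 s.2 else a
    | none => a
  causal := by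
    intro d r x y hxy
    funext l
    cases hs : (Encodable.decode r.unpair.1 : Option (Σ i, Fin (M.demand i))) with
    | none => rfl
    | some s =>
      simp only
      split_ifs with hd
      · cases hn : M.G.dist (M.src s.1) d.fst with
        | zero =>
          rw [hxy.1 s.1 ((M.connected _ _).dist_eq_zero_iff.1 hn)]
        | succ n =>
          obtain ⟨w, hw, hwn⟩ := exists_adj_dist_le M.connected hn
          have hlt : Nat.pair r.unpair.1 n < r := by
            conv_rhs => rw [← Nat.pair_unpair r]
            exact Nat.pair_lt_pair_right _ (by omega)
          have h := congrFun (hxy.2 ⟨(w, d.fst), hw⟩ rfl _ hlt)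
            ⟨0, M.one_le_cap _ (SimpleGraph.Dart.edge_mem ⟨(w, d.fst), hw⟩)⟩
          simpa [Nat.unpair_pair, hs, hwn] using h
      · rfl

theorem flooding_send (M : UnicastInstance) (a : Γ) (d : M.G.Dart) (s : Σ i, Fin (M.demand i))
    (t : ℕ) (x : M.Messages Γ) (l : Fin (M.cap d.edge)) :
    (M.flooding a).send d (Nat.pair (Encodable.encode s) t) x l =
      if M.G.dist (M.src s.1) d.fst ≤ t then x s.1 s.2 else a := by
  simp [-Encodable.decode_sigma_val, flooding]

theorem flooding_isRouting (M : UnicastInstance) (a : Γ) : (M.flooding a).IsRouting := by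
  intro d r l
  cases hs : (Encodable.decode r.unpair.1 : Option (Σ i, Fin (M.demand i))) with
  | none => exact .inl ⟨a, fun x => by simp [-Encodable.decode_sigma_val, flooding, hs]⟩
  | some s =>
    by_cases hd : M.G.dist (M.src s.1) d.fst ≤ r.unpair.2
    · refine .inr ⟨s.1, s.2, ?_, fun x => by simp [-Encodable.decode_sigma_val, flooding, hs, hd]⟩
      cases hn : M.G.dist (M.src s.1) d.fst with
      | zero => exact .inl ((M.connected _ _).dist_eq_zero_iff.1 hn)
      | succ n =>
        obtain ⟨w, hw, hwn⟩ := exists_adj_dist_le M.connected hn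
        refine .inr ⟨⟨(w, d.fst), hw⟩, rfl, Nat.pair r.unpair.1 n, ?_,
          ⟨0, M.one_le_cap _ (SimpleGraph.Dart.edge_mem ⟨(w, d.fst), hw⟩)⟩, fun x => ?_⟩
        · conv_rhs => rw [← Nat.pair_unpair r]
          exact Nat.pair_lt_pair_right _ (by omega)
        · simp [-Encodable.decode_sigma_val, flooding, Nat.unpair_pair, hs, hwn]
    · exact .inl ⟨a, fun x => by simp [-Encodable.decode_sigma_val, flooding, hs, hd]⟩

/-- Needed because the infimum of an empty set of routing costs would be 0. Rounds are divided among
the packets by the pairing function, and each packet floods the connected graph. -/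
theorem exists_routing (M : UnicastInstance) (Γ : Type) [Nonempty Γ] :
    ∃ (P : M.Protocol Γ) (T : Fin M.k → ℕ), P.IsRouting ∧ P.HasCompletionTimes T := by
  obtain ⟨a⟩ := ‹Nonempty Γ›
  refine ⟨M.flooding a, fun i => ∑ j : Fin (M.demand i),
    (Nat.pair (Encodable.encode (⟨i, j⟩ : Σ i, Fin (M.demand i)))
      (M.G.dist (M.src i) (M.snk i)) + 1), M.flooding_isRouting a, fun i x y hxy => ?_⟩
  cases hn : M.G.dist (M.src i) (M.snk i) with
  | zero => exact hxy.1 i ((M.connected _ _).dist_eq_zero_iff.1 hn)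
  | succ n =>
    funext j
    obtain ⟨w, hw, hwn⟩ := exists_adj_dist_le M.connected hn
    have hlt : Nat.pair (Encodable.encode (⟨i, j⟩ : Σ i, Fin (M.demand i))) n <
        ∑ j : Fin (M.demand i), (Nat.pair (Encodable.encode (⟨i, j⟩ : Σ i, Fin (M.demand i)))
          (M.G.dist (M.src i) (M.snk i)) + 1) := by
      have h1 := Finset.single_le_sum (f := fun j : Fin (M.demand i) =>
        Nat.pair (Encodable.encode (⟨i, j⟩ : Σ i, Fin (M.demand i)))
          (M.G.dist (M.src i) (M.snk i)) + 1) (fun _ _ => Nat.zero_le _) (Finset.mem_univ j)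
      have h2 := Nat.pair_lt_pair_right (Encodable.encode (⟨i, j⟩ : Σ i, Fin (M.demand i)))
        (show n < M.G.dist (M.src i) (M.snk i) by omega)
      omega
    have h := congrFun (hxy.2 ⟨(w, M.snk i), hw⟩ rfl _ hlt)
      ⟨0, M.one_le_cap _ (SimpleGraph.Dart.edge_mem ⟨(w, M.snk i), hw⟩)⟩
    simpa only [flooding_send, hwn, if_true] using h

namespace Protocol

variable {P : M.Protocol Γ}

open Classical in
/-- The messages that are `a` at one sub-packet and `b` at all others. -/
noncomputable def singleMessage (s : Σ i, Fin (M.demand i)) (a b : Γ) : M.Messages Γ :=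
  fun i j => if (⟨i, j⟩ : Σ i, Fin (M.demand i)) = s then a else b

theorem Carries.eq [Nontrivial Γ] {d : M.G.Dart} {r : ℕ} {l : Fin (M.cap d.edge)}
    {s s' : Σ i, Fin (M.demand i)} (h : P.Carries d r l s.1 s.2) (h' : P.Carries d r l s'.1 s'.2) :
    s = s' := by
  by_contra hne
  obtain ⟨a, b, hab⟩ := exists_pair_ne Γ
  have := (h (singleMessage s a b)).symm.trans (h' _)
  simp [singleMessage, Ne.symm hne] at this
  exact hab this

theorem Carries.holds [Nontrivial Γ] (hP : P.IsRouting) {d : M.G.Dart} {r : ℕ}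
    {l : Fin (M.cap d.edge)} {i : Fin M.k} {j : Fin (M.demand i)} (h : P.Carries d r l i j) :
    P.Holds d.fst r i j := by
  rcases hP d r l with ⟨c, hc⟩ | ⟨i', j', hh, hc⟩
  · obtain ⟨a, b, hab⟩ := exists_pair_ne Γ
    refine absurd ?_ hab
    have h1 := h fun _ _ => a
    have h2 := h fun _ _ => b
    rw [hc] at h1 h2
    exact h1.symm.trans h2
  · have := Carries.eq (s := ⟨i, j⟩) (s' := ⟨i', j'⟩) h hc
    cases this
    exact hh

/-- If the sink lacks the sub-packet, changing only that symbol changes nothing that the sink sees.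
-/
theorem HasCompletionTimes.holds [Nontrivial Γ] (hP : P.IsRouting) {T : Fin M.k → ℕ}
    (hT : P.HasCompletionTimes T) (i : Fin M.k) (j : Fin (M.demand i)) :
    P.Holds (M.snk i) (T i) i j := by
  by_contra hn
  obtain ⟨a, b, hab⟩ := exists_pair_ne Γ
  have hne : ∀ i' j', (⟨i', j'⟩ : Σ i, Fin (M.demand i)) ≠ ⟨i, j⟩ →
      singleMessage ⟨i, j⟩ a b i' j' = b := fun i' j' h => by simp [singleMessage, h]
  have key := hT i (singleMessage ⟨i, j⟩ a b) (fun _ _ => b) ⟨?_, ?_⟩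
  · have := congrFun key j
    simp [singleMessage] at this
    exact hab this
  · intro i' hi'
    funext j'
    refine hne i' j' fun h => hn (.inl ?_)
    cases h
    exact hi'
  · intro d hd r hr
    funext l
    rcases hP d r l with ⟨c, hc⟩ | ⟨i', j', -, hc⟩
    · rw [hc, hc]
    · rw [hc, hc]
      refine hne i' j' fun h => hn (.inr ⟨d, hd, r, hr, l, ?_⟩)
      cases h
      exact hc

theorem HasCompletionTimes.one_le [Nontrivial Γ] {T : Fin M.k → ℕ}
    (hT : P.HasCompletionTimes T) (i : Fin M.k) (hi : ∀ i', M.src i' ≠ M.snk i) : 1 ≤ T i := by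
  by_contra! h0
  obtain ⟨a, b, hab⟩ := exists_pair_ne Γ
  have := hT i (fun _ _ => a) (fun _ _ => b)
    ⟨fun i' hi' => absurd hi' (hi i'), fun d _ r hr => by omega⟩
  exact hab (congrFun this ⟨0, M.one_le_demand i⟩)

end Protocol

end UnicastInstance

/-! ### Bounds for the `ℓ_p` costs -/

theorem lpCost_le {k : ℕ} (hk : 0 < k) {p : ℝ≥0∞} (hp : 0 < p) {t : Fin k → ℝ} {a : ℝ}
    (ht : ∀ i, 0 ≤ t i) (hta : ∀ i, t i ≤ a) : lpCost p t ≤ a * (k : ℝ) ^ (1 / p).toReal := by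
  have : Nonempty (Fin k) := ⟨⟨0, hk⟩⟩
  have ha : 0 ≤ a := (ht ⟨0, hk⟩).trans (hta _)
  rcases eq_or_ne p ∞ with rfl | hp'
  · rw [lpCost, PiLp.norm_eq_ciSup]
    simp only [ENNReal.div_top, ENNReal.toReal_zero, Real.rpow_zero, mul_one]
    exact ciSup_le fun i => by simpa [abs_of_nonneg (ht i)] using hta i
  · have hpos : 0 < p.toReal := ENNReal.toReal_pos hp.ne' hp'
    rw [lpCost, PiLp.norm_eq_sum hpos]
    have h1 : ∑ i, ‖(WithLp.toLp p t) i‖ ^ p.toReal ≤ k * a ^ p.toReal := by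
      calc _ ≤ ∑ _i : Fin k, a ^ p.toReal := Finset.sum_le_sum fun i _ => by
            refine Real.rpow_le_rpow (norm_nonneg _) ?_ hpos.le
            simpa [abs_of_nonneg (ht i)] using hta i
        _ = _ := by simp
    refine (Real.rpow_le_rpow (Finset.sum_nonneg fun i _ => by positivity) h1
      (by positivity)).trans (le_of_eq ?_)
    rw [Real.mul_rpow (by positivity) (by positivity), ← Real.rpow_mul ha,
      mul_one_div_cancel hpos.ne', Real.rpow_one, mul_comm]
    simp

theorem le_lpCost {k : ℕ} (hk : 0 < k) {p : ℝ≥0∞} (hp : 0 < p) {t : Fin k → ℝ} {b : ℝ}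
    (hb : 0 ≤ b) {S : Finset (Fin k)} (hS : k ≤ 2 * S.card) (ht : ∀ i ∈ S, b ≤ t i) :
    b * ((k : ℝ) / 2) ^ (1 / p).toReal ≤ lpCost p t := by
  have hS0 : 0 < S.card := by omega
  obtain ⟨i₀, hi₀⟩ := Finset.card_pos.1 hS0
  have hle : ∀ i ∈ S, b ≤ ‖t i‖ := fun i hi => (ht i hi).trans (Real.le_norm_self _)
  rcases eq_or_ne p ∞ with rfl | hp'
  · rw [lpCost, PiLp.norm_eq_ciSup]
    simp only [ENNReal.div_top, ENNReal.toReal_zero, Real.rpow_zero, mul_one]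
    exact (hle i₀ hi₀).trans (le_ciSup (f := fun i => ‖t i‖) (Set.finite_range _).bddAbove i₀)
  · have hpos : 0 < p.toReal := ENNReal.toReal_pos hp.ne' hp'
    rw [lpCost, PiLp.norm_eq_sum hpos]
    have hkS : (k : ℝ) / 2 ≤ S.card := by
      rw [div_le_iff₀ two_pos, mul_comm]
      exact_mod_cast hS
    have h1 : (k : ℝ) / 2 * b ^ p.toReal ≤ ∑ i, ‖(WithLp.toLp p t) i‖ ^ p.toReal := by
      calc _ ≤ S.card * b ^ p.toReal := mul_le_mul_of_nonneg_right hkS (by positivity)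
        _ = ∑ _i ∈ S, b ^ p.toReal := by simp
        _ ≤ ∑ i ∈ S, ‖(WithLp.toLp p t) i‖ ^ p.toReal := Finset.sum_le_sum fun i hi =>
            Real.rpow_le_rpow hb (hle i hi) hpos.le
        _ ≤ _ := Finset.sum_le_univ_sum_of_nonneg fun i => by positivity
    refine le_trans (le_of_eq ?_) (Real.rpow_le_rpow (by positivity) h1
      (by positivity : (0 : ℝ) ≤ 1 / p.toReal))
    rw [Real.mul_rpow (by positivity) (by positivity), ← Real.rpow_mul hb,
      mul_one_div_cancel hpos.ne', Real.rpow_one, mul_comm]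
    simp

/-! ### Realization as a simple unicast instance -/

namespace OrientedNetwork

variable {K W F A : Type}

/-- The directed edges of the realization: each arc is subdivided by a vertex, a path of length `n`
starts at each node, and the ends of these paths form a clique. -/
def Link (N : OrientedNetwork K W F A) (n : ℕ) :
    (Node K W × Fin (n + 1)) ⊕ (F ⊕ A) → (Node K W × Fin (n + 1)) ⊕ (F ⊕ A) → Prop
  | .inl c, .inl c' => c.1 = c'.1 ∧ c.2.val + 1 = c'.2.val ∨ c.2.val = n ∧ c'.2.val = n
  | .inl c, .inr e => c.2 = 0 ∧ (c.1 = N.tail e ∨ c.1 = N.head e)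
  | .inr _, _ => False

/-- The graph of the realization. -/
def realGraph (N : OrientedNetwork K W F A) (n : ℕ) :
    SimpleGraph ((Node K W × Fin (n + 1)) ⊕ (F ⊕ A)) :=
  SimpleGraph.fromRel (N.Link n)

theorem realGraph_adj_tail (N : OrientedNetwork K W F A) (n : ℕ) (e : F ⊕ A) :
    (N.realGraph n).Adj (.inl (N.tail e, 0)) (.inr e) :=
  ⟨by simp, .inl ⟨rfl, .inl rfl⟩⟩

theorem realGraph_adj_head (N : OrientedNetwork K W F A) (n : ℕ) (e : F ⊕ A) :
    (N.realGraph n).Adj (.inr e) (.inl (N.head e, 0)) :=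
  ⟨by simp, .inr ⟨rfl, .inr rfl⟩⟩

theorem realGraph_adj_inr {N : OrientedNetwork K W F A} {n : ℕ} {e : F ⊕ A}
    {c : (Node K W × Fin (n + 1)) ⊕ (F ⊕ A)} (h : (N.realGraph n).Adj c (.inr e)) :
    c = .inl (N.tail e, 0) ∨ c = .inl (N.head e, 0) := by
  rcases c with ⟨c, j⟩ | c <;> rcases h with ⟨-, h | h⟩ <;> simp [Link] at h ⊢
  rcases h with ⟨rfl, h⟩
  simpa using h

theorem realGraph_connected (N : OrientedNetwork K W F A) (n : ℕ) [Nonempty K] :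
    (N.realGraph n).Connected := by
  obtain ⟨i⟩ := ‹Nonempty K›
  have top : ∀ c, (N.realGraph n).Reachable (.inl (c, Fin.last n)) (.inl (.src i, Fin.last n)) := by
    intro c
    by_cases hc : c = .src i
    · rw [hc]
    · exact SimpleGraph.Adj.reachable ⟨by simp [hc], .inl (.inr ⟨rfl, rfl⟩)⟩
  have col : ∀ c (t : ℕ) (m : Fin (n + 1)), m.val + t = n →
      (N.realGraph n).Reachable (.inl (c, m)) (.inl (.src i, Fin.last n)) := by
    intro c t
    induction t with
    | zero =>
      intro m hm
      obtain rfl : m = Fin.last n := Fin.ext hm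
      exact top c
    | succ t ih =>
      intro m hm
      refine SimpleGraph.Reachable.trans (SimpleGraph.Adj.reachable ?_)
        (ih ⟨m + 1, by omega⟩ (by simp only; omega))
      exact ⟨by simp [Fin.ext_iff], .inl (.inl ⟨rfl, rfl⟩)⟩
  have all : ∀ c, (N.realGraph n).Reachable c (.inl (.src i, Fin.last n)) := by
    rintro (⟨c, m⟩ | e)
    · exact col c (n - m) m (by omega)
    · exact (N.realGraph_adj_head n e).reachable.trans (col _ n 0 (by simp))
  exact (SimpleGraph.connected_iff _).2 ⟨fun c c' => (all c).trans (all c').symm, ⟨.inl (.src i, 0)⟩⟩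

/-- The potential on the realization. -/
def realPotential (N : OrientedNetwork K W F A) (n : ℕ) (φ : Node K W → ℕ) :
    (Node K W × Fin (n + 1)) ⊕ (F ⊕ A) → ℕ
  | .inl c => 2 * φ c.1 - c.2
  | .inr e => φ (N.tail e) + φ (N.head e)

/-- Subdivision doubles `φ`. Since `φ ≤ b`, paths of length `2 * b` bring the potential down to 0,
so the clique that ensures connectedness creates no shortcut. -/
theorem IsPotential.realPotential_le {N : OrientedNetwork K W F A} {b : ℕ} {i : K}
    {φ : Node K W → ℕ} (h : N.IsPotential b i φ) {c c' : (Node K W × Fin (2 * b + 1)) ⊕ (F ⊕ A)}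
    (hadj : (N.realGraph (2 * b)).Adj c c') (hc : ∀ f, c ≠ .inr (.inl f))
    (hc' : ∀ f, c' ≠ .inr (.inl f)) :
    N.realPotential (2 * b) φ c' ≤ N.realPotential (2 * b) φ c + 1 := by
  have key : ∀ c c', N.Link (2 * b) c c' → (∀ f, c ≠ .inr (.inl f)) → (∀ f, c' ≠ .inr (.inl f)) →
      N.realPotential (2 * b) φ c' ≤ N.realPotential (2 * b) φ c + 1 ∧
        N.realPotential (2 * b) φ c ≤ N.realPotential (2 * b) φ c' + 1 := by
    rintro (⟨c, j⟩ | e) (⟨c', j'⟩ | e') hl h1 h2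
    · simp only [realPotential]
      rcases hl with ⟨h3, h4⟩ | ⟨h3, h4⟩
      · simp only at h3 h4
        subst h3
        omega
      · have := h.le c
        have := h.le c'
        simp only at h3 h4
        omega
    · rcases e' with f | e
      · exact absurd rfl (h2 f)
      · have h3 := h.head_le e
        have h4 := h.tail_le e
        obtain ⟨h5, h6⟩ := hl
        simp only at h5 h6
        simp only [realPotential, h5, Fin.val_zero]
        rcases h6 with rfl | rfl <;> omega
    · exact hl.elim
    · exact hl.elim
  rcases hadj.2 with hl | hl
  · exact (key _ _ hl hc hc').1
  · exact (key _ _ hl hc' hc).2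

variable [Finite K] [Finite W] [Finite F] [Finite A] [Nonempty K]

/-- The network as a simple multiple-unicast instance. -/
noncomputable def realize (N : OrientedNetwork K W F A) (n : ℕ) : UnicastInstance where
  V := (Node K W × Fin (n + 1)) ⊕ (F ⊕ A)
  finite := inferInstance
  G := N.realGraph n
  connected := N.realGraph_connected n
  cap _ := 1
  one_le_cap _ _ := le_rfl
  k := Nat.card K
  src i := .inl (.src ((Finite.equivFin K).symm i), 0)
  snk i := .inl (.snk ((Finite.equivFin K).symm i), 0)
  demand _ := 1
  one_le_demand _ := le_rfl

theorem realize_isSimple (N : OrientedNetwork K W F A) (n : ℕ) : (N.realize n).IsSimple :=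
  ⟨fun _ _ => rfl, fun _ => rfl⟩

/-- The packets of the realization as packets of the network. -/
noncomputable def realMessage {N : OrientedNetwork K W F A} {n : ℕ} {Γ : Type}
    (x : (N.realize n).Messages Γ) : K → Γ :=
  fun i => x (Finite.equivFin K i) (0 : Fin 1)

open Classical in
/-- The symbol that is sent from one vertex of the realization to another. -/
noncomputable def realSymbol (N : OrientedNetwork K W F A) (n : ℕ) {Γ : Type} [Zero Γ]
    (σ : F ⊕ A → (K → Γ) → Γ) (x : K → Γ) (r : ℕ) :
    (Node K W × Fin (n + 1)) ⊕ (F ⊕ A) → (Node K W × Fin (n + 1)) ⊕ (F ⊕ A) → Γ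
  | .inl c, .inr e => if c.1 = N.tail e ∧ r = 2 * N.time e then σ e x else 0
  | .inr e, .inl c => if c.1 = N.head e ∧ r = 2 * N.time e + 1 then σ e x else 0
  | _, _ => 0

/-- Time `t` becomes round `2 * t` from the tail to the midpoint of an arc and round `2 * t + 1`
from there to its head. -/
theorem HasCode.exists_protocol {N : OrientedNetwork K W F A} {a : ℕ} (h : N.HasCode a) (n : ℕ)
    (Γ : Type) [AddCommGroup Γ] :
    ∃ P : (N.realize n).Protocol Γ, P.HasCompletionTimes fun _ => 2 * a := by
  obtain ⟨ht, h⟩ := h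
  obtain ⟨σ, hc, hd⟩ := h Γ
  let send : (d : (N.realize n).G.Dart) → ℕ → (N.realize n).Messages Γ →
      Fin ((N.realize n).cap d.edge) → Γ :=
    fun d r x _ => N.realSymbol n σ (realMessage x) r d.fst d.snd
  have arc : ∀ {u : (N.realize n).V} {r : ℕ} {x y : (N.realize n).Messages Γ} (e : F ⊕ A),
      UnicastInstance.SameHistory send u r x y → .inl (N.head e, 0) = u → 2 * N.time e + 1 < r →
      σ e (realMessage x) = σ e (realMessage y) := by
    intro u r x y e hxy hu hr
    have := congrFun (hxy.2 ⟨(.inr e, .inl (N.head e, 0)), N.realGraph_adj_head n e⟩ hu _ hr)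
      (0 : Fin 1)
    simpa [send, realSymbol] using this
  have source : ∀ {u : (N.realize n).V} {r : ℕ} {x y : (N.realize n).Messages Γ} (i : K),
      UnicastInstance.SameHistory send u r x y → .inl (.src i, 0) = u →
      realMessage x i = realMessage y i := by
    intro u r x y i hxy hu
    have := hxy.1 (Finite.equivFin K i) (by simpa [realize] using hu)
    exact congrFun this (0 : Fin 1)
  refine ⟨⟨send, ?_⟩, ?_⟩
  · rintro ⟨⟨c, c'⟩, hadj⟩ r x y hxy
    funext l
    rcases c with ⟨c, j⟩ | e <;> rcases c' with ⟨c', j'⟩ | e'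
    · rfl
    · by_cases hr : c = N.tail e' ∧ r = 2 * N.time e'
      · obtain ⟨rfl, rfl⟩ := hr
        obtain rfl : j = 0 := by
          rcases realGraph_adj_inr hadj with h | h <;> simp at h
          exacts [h, h.2]
        have := hc e' (realMessage x) (realMessage y)
          ⟨fun i hi => source i hxy (by rw [hi]), fun e he hlt => arc e hxy (by rw [he]) (by omega)⟩
        simpa [send, realSymbol] using this
      · simp [send, realSymbol, hr]
    · by_cases hr : c' = N.head e ∧ r = 2 * N.time e + 1
      · obtain ⟨rfl, rfl⟩ := hr
        have := congrFun (hxy.2 ⟨(.inl (N.tail e, 0), .inr e), N.realGraph_adj_tail n e⟩ rfl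
          (2 * N.time e) (Nat.lt_succ_self _)) (0 : Fin 1)
        simpa [send, realSymbol] using this
      · simp [send, realSymbol, hr]
    · rfl
  · intro i x y hxy
    have := hd ((Finite.equivFin K).symm i) (realMessage x) (realMessage y)
      ⟨fun i' hi' => (nomatch hi'), fun e he hlt => arc e hxy (congrArg
        (fun c => (Sum.inl (c, 0) : (Node K W × Fin (n + 1)) ⊕ (F ⊕ A))) he) (by simp only; omega)⟩
    have hi : ∀ i', i' = i → x i' (0 : Fin 1) = y i' (0 : Fin 1) →
        x i (0 : Fin 1) = y i (0 : Fin 1) := by rintro _ rfl h; exact h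
    funext j
    obtain rfl : j = (0 : Fin 1) := Subsingleton.elim (α := Fin 1) _ _
    exact hi _ (Equiv.apply_symm_apply _ _) this

/-- Packets that are early at their sinks pass through a cut arc. -/
theorem IsPotential.exists_cut {N : OrientedNetwork K W F A} {b : ℕ} {Γ : Type} [Nontrivial Γ]
    {P : (N.realize (2 * b)).Protocol Γ} (hP : P.IsRouting) {i : Fin (Nat.card K)}
    {φ : Node K W → ℕ} (h : N.IsPotential b ((Finite.equivFin K).symm i) φ) {j : Fin 1} (r : ℕ)
    (u : (Node K W × Fin (2 * b + 1)) ⊕ (F ⊕ A)) (hu : P.Holds u r i j) :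
    (∃ d r', r' < r ∧ (∃ f, d.snd = .inr (.inl f)) ∧ ∃ l, P.Carries d r' l i j) ∨
      (∀ f, u ≠ .inr (.inl f)) ∧ N.realPotential (2 * b) φ u ≤ r := by
  induction r using Nat.strong_induction_on generalizing u with
  | _ r ih =>
    rcases hu with hu | ⟨d, rfl, r', hr', l, hc⟩
    · refine .inr ?_
      rw [← hu]
      exact ⟨fun f hf => (by cases hf), by simp [realize, realPotential, h.src]⟩
    · by_cases hcut : ∃ f, d.snd = .inr (.inl f)
      · exact .inl ⟨d, r', hr', hcut, l, hc⟩
      · rcases ih r' hr' d.fst (hc.holds hP) with ⟨d', r'', hr'', hd'⟩ | ⟨h1, h2⟩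
        · exact .inl ⟨d', r'', hr''.trans hr', hd'⟩
        · refine .inr ⟨fun f hf => hcut ⟨f, hf⟩, ?_⟩
          have := h.realPotential_le d.adj h1 (fun f hf => hcut ⟨f, hf⟩)
          omega

/-- With routing, few sessions are completed early. -/
theorem IsSeparated.card_le {N : OrientedNetwork K W F A} {b : ℕ} (h : N.IsSeparated b) {Γ : Type}
    [Nontrivial Γ] {P : (N.realize (2 * b)).Protocol Γ} (hP : P.IsRouting)
    {T : Fin (Nat.card K) → ℕ} (hT : P.HasCompletionTimes T) :
    Nat.card {i // T i < 2 * b} ≤ 4 * b * Nat.card F := by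
  have cut : ∀ i : {i // T i < 2 * b}, ∃ (d : (N.realize (2 * b)).G.Dart) (r : Fin (2 * b)) (f : F),
      d.snd = .inr (.inl f) ∧ ∃ l, P.Carries d r l i.1 (0 : Fin 1) := by
    rintro ⟨i, hi⟩
    obtain ⟨φ, hφ⟩ := h ((Finite.equivFin K).symm i)
    rcases hφ.exists_cut hP _ _ (hT.holds hP i (0 : Fin 1)) with ⟨d, r, hr, ⟨f, hf⟩, hl⟩ | ⟨-, h2⟩
    · exact ⟨d, ⟨r, hr.trans hi⟩, f, hf, hl⟩
    · simp [realize, realPotential, hφ.snk] at h2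
      omega
  choose d r f hd l hl using cut
  classical
  -- An early packet is charged to a use of a cut arc: which arc, from which end its midpoint is
  -- entered, and in which round. One symbol is one packet, so the charge is injective.
  let g : {i // T i < 2 * b} → F × Bool × Fin (2 * b) := fun i =>
    (f i, decide ((d i).fst = .inl (N.tail (.inl (f i)), 0)), r i)
  have hg : Function.Injective g := by
    intro i i' hii
    simp only [g, Prod.mk.injEq, decide_eq_decide] at hii
    obtain ⟨hf, hb, hr⟩ := hii
    have hdd : d i = d i' := by
      have h1 : (d i).snd = (d i').snd := by rw [hd, hd, hf]
      have h2 : (d i).fst = (d i').fst := by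
        have h3 := realGraph_adj_inr (hd i ▸ (d i).adj)
        have h4 := realGraph_adj_inr (hd i' ▸ (d i').adj)
        rw [← hf] at hb h4
        by_cases h5 : (d i).fst = .inl (N.tail (.inl (f i)), 0)
        · exact h5.trans (hb.1 h5).symm
        · exact (h3.resolve_left h5).trans (h4.resolve_left fun h6 => h5 (hb.2 h6)).symm
      exact SimpleGraph.Dart.ext _ _ (Prod.ext h2 h1)
    have h1 := hl i
    have h2 := hl i'
    have h3 : ∀ (d' : (N.realize (2 * b)).G.Dart) (r' : ℕ)
        (l₁ l₂ : Fin ((N.realize (2 * b)).cap d'.edge)) (i₁ i₂ : Fin (Nat.card K)),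
        P.Carries d' r' l₁ i₁ (0 : Fin 1) → P.Carries d' r' l₂ i₂ (0 : Fin 1) → i₁ = i₂ := by
      intro d' r' l₁ l₂ i₁ i₂ hc₁ hc₂
      obtain rfl : l₁ = l₂ := Subsingleton.elim (α := Fin 1) _ _
      exact congrArg Sigma.fst (UnicastInstance.Protocol.Carries.eq
        (M := N.realize (2 * b)) (s := ⟨i₁, (0 : Fin 1)⟩) (s' := ⟨i₂, (0 : Fin 1)⟩) hc₁ hc₂)
    revert h1 h2
    generalize l i = l₁
    generalize l i' = l₂
    revert l₁ l₂
    rw [hdd, hr]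
    exact fun l₁ l₂ h1 h2 => Subtype.ext (h3 _ _ _ _ _ _ h1 h2)
  refine (Nat.card_le_card_of_injective g hg).trans (le_of_eq ?_)
  simp only [Nat.card_prod, Nat.card_fin, Nat.card_eq_fintype_card (α := Bool), Fintype.card_bool]
  ring

theorem le_codingGap {N : OrientedNetwork K W F A} {a b : ℕ} (hc : N.HasCode a)
    (hs : N.IsSeparated b) (hk : 8 * b * Nat.card F ≤ Nat.card K) {p : ℝ≥0∞} (hp : 0 < p)
    (Γ : Type) [Finite Γ] [Nontrivial Γ] :
    (1 / 2 : ℝ) ^ (1 / p).toReal * (b / a) ≤ (N.realize (2 * b)).codingGap Γ (lpCost p) := by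
  have hk0 : 0 < Nat.card K := Nat.card_pos
  set q := (1 / p).toReal
  have : NeZero (Nat.card Γ) := ⟨Nat.card_pos.ne'⟩
  -- Any finite alphabet is made a cyclic group, so that the codes apply.
  let _ : AddCommGroup Γ := ((Finite.equivFin Γ).trans (ZMod.finEquiv _).toEquiv).addCommGroup
  have hnum : (2 * b : ℝ) * ((Nat.card K : ℝ) / 2) ^ q ≤
      sInf ((N.realize (2 * b)).routingCosts Γ (lpCost p)) := by
    refine le_csInf ?_ ?_
    · obtain ⟨P, T, hP, hT⟩ := (N.realize (2 * b)).exists_routing Γ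
      exact ⟨_, P, T, hP, hT, rfl⟩
    · rintro _ ⟨P, T, hP, hT, rfl⟩
      classical
      have h1 := hs.card_le hP hT
      refine le_lpCost (S := Finset.univ.filter fun i => ¬ T i < 2 * b) hk0 hp (by positivity) ?_ ?_
      · have h2 := Finset.card_filter_add_card_filter_not (s := Finset.univ)
          (fun i : Fin (Nat.card K) => T i < 2 * b)
        rw [Finset.card_univ, Fintype.card_fin] at h2
        rw [Nat.card_eq_fintype_card, Fintype.card_subtype] at h1
        have h3 : 8 * b * Nat.card F = 2 * (4 * b * Nat.card F) := by ring
        change Nat.card K ≤ _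
        change _ ≤ _ at h1
        omega
      · intro i hi
        have : 2 * b ≤ T i := by simpa using hi
        exact_mod_cast this
  have hlow : ∀ c ∈ (N.realize (2 * b)).codingCosts Γ (lpCost p),
      (1 : ℝ) * ((Nat.card K : ℝ) / 2) ^ q ≤ c := by
    rintro _ ⟨P, T, hT, rfl⟩
    refine le_lpCost (S := Finset.univ) hk0 hp zero_le_one ?_ fun i _ => ?_
    · rw [Finset.card_univ, Fintype.card_fin]
      omega
    · have := hT.one_le i fun i' h => by simp [realize] at h
      exact_mod_cast this
  obtain ⟨P, hP⟩ := hc.exists_protocol (2 * b) Γ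
  have hmem : lpCost p (fun _ : Fin (Nat.card K) => ((2 * a : ℕ) : ℝ)) ∈
      (N.realize (2 * b)).codingCosts Γ (lpCost p) := ⟨P, _, hP, rfl⟩
  -- No sink is a source, so every completion time is at least 1; this excludes a zero denominator.
  have hpos : 0 < sInf ((N.realize (2 * b)).codingCosts Γ (lpCost p)) :=
    lt_of_lt_of_le (by positivity) (le_csInf ⟨_, hmem⟩ hlow)
  have hden : sInf ((N.realize (2 * b)).codingCosts Γ (lpCost p)) ≤
      (2 * a : ℝ) * (Nat.card K : ℝ) ^ q := by
    refine (csInf_le ⟨_, hlow⟩ hmem).trans (lpCost_le hk0 hp (fun _ => by positivity) fun _ => ?_)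
    push_cast
    exact le_rfl
  have hKq : (0 : ℝ) < (Nat.card K : ℝ) ^ q := by positivity
  calc (1 / 2 : ℝ) ^ q * (b / a) =
        (2 * b : ℝ) * ((Nat.card K : ℝ) / 2) ^ q / ((2 * a : ℝ) * (Nat.card K : ℝ) ^ q) := by
        rw [div_eq_mul_one_div (Nat.card K : ℝ), Real.mul_rpow (by positivity) (by positivity)]
        field_simp
    _ ≤ _ := div_le_div₀ ((by positivity : (0 : ℝ) ≤ _).trans hnum) hnum hpos hden

end OrientedNetwork

/-! ### The sequence of instances -/

open OrientedNetwork in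
theorem exists_unicastInstance_gap (i : ℕ) : ∃ M : UnicastInstance, M.IsSimple ∧ i ≤ M.k ∧
    Real.log M.k ≤ (163840 : ℝ) ^ 2 ^ i ∧
    ∀ p : ℝ≥0∞, 0 < p → ∀ (Γ : Type) [Finite Γ] [Nontrivial Γ],
      (1 / 2 : ℝ) ^ (1 / p).toReal * (4 / 3) ^ 2 ^ i ≤ M.codingGap Γ (lpCost p) := by
  obtain ⟨e, -, h⟩ := exists_gapFamily i
  have hb : 0 < 4 ^ 2 ^ i := by positivity
  obtain ⟨K, W, F, A, _, _, _, _, N, hc, hs, hf, hk, -, hks, -⟩ := h (8 * 4 ^ 2 ^ i) (by omega)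
  have hle : 8 * 4 ^ 2 ^ i ≤ Nat.card K := (Nat.le_mul_of_pos_right _ hf).trans hk
  have hpos : 0 < Nat.card K := by omega
  have : Nonempty K := (Nat.card_pos_iff.1 hpos).1
  refine ⟨N.realize (2 * 4 ^ 2 ^ i), N.realize_isSimple _, ?_, ?_, fun p hp Γ _ _ => ?_⟩
  · have h1 : i < 2 ^ i := Nat.lt_two_pow_self
    have h2 : 2 ^ i < 4 ^ 2 ^ i := Nat.lt_pow_self (by norm_num)
    change i ≤ Nat.card K
    omega
  · change Real.log (Nat.card K : ℝ) ≤ _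
    have h1 : (Nat.card K : ℝ) ≤ ((8 * 4 ^ 2 ^ i : ℕ) : ℝ) ^ 5120 ^ 2 ^ i := by exact_mod_cast hks
    have h2 : ((8 * 4 ^ 2 ^ i : ℕ) : ℝ) ≤ 32 ^ 2 ^ i := by
      have h3 : 8 ≤ 8 ^ 2 ^ i := Nat.le_self_pow (by positivity) 8
      have h4 : 8 * 4 ^ 2 ^ i ≤ 32 ^ 2 ^ i := by
        calc _ ≤ 8 ^ 2 ^ i * 4 ^ 2 ^ i := Nat.mul_le_mul_right _ h3
          _ = 32 ^ 2 ^ i := by rw [← mul_pow]; norm_num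
      exact_mod_cast h4
    calc _ ≤ Real.log (((8 * 4 ^ 2 ^ i : ℕ) : ℝ) ^ 5120 ^ 2 ^ i) :=
          Real.log_le_log (by exact_mod_cast hpos) h1
      _ = 5120 ^ 2 ^ i * Real.log ((8 * 4 ^ 2 ^ i : ℕ) : ℝ) := by
          rw [Real.log_pow]; push_cast; rfl
      _ ≤ 5120 ^ 2 ^ i * 32 ^ 2 ^ i :=
          mul_le_mul_of_nonneg_left ((Real.log_le_self (by positivity)).trans h2) (by positivity)
      _ = _ := by rw [← mul_pow]; norm_num
  · have := le_codingGap hc hs hk hp Γ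
    push_cast at this
    rwa [← div_pow] at this

theorem mainTheorem8 :
    ∃ c : ℝ, 0 < c ∧ ∃ M : ℕ → UnicastInstance,
      Filter.Tendsto (fun n => (M n).k) Filter.atTop Filter.atTop ∧
      (∀ n, (M n).IsSimple) ∧
      ∀ p₀ : ℝ≥0∞, 0 < p₀ → ∃ C : ℝ, 0 < C ∧
        ∀ p : ℝ≥0∞, p₀ ≤ p → ∀ (Γ : Type) [Finite Γ] [Nontrivial Γ], ∀ n : ℕ,
          C * Real.log ((M n).k : ℝ) ^ c ≤ (M n).codingGap Γ (lpCost p) := by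
  choose M hsimple hk hlog hgap using exists_unicastInstance_gap
  -- This exponent turns the bound `163840 ^ 2 ^ n` on the logarithm, where `163840 = 5120 * 32`,
  -- into exactly `(4 / 3) ^ 2 ^ n`.
  have hc : 0 < Real.logb 163840 (4 / 3) := Real.logb_pos (by norm_num) (by norm_num)
  refine ⟨Real.logb 163840 (4 / 3), hc, M, Filter.tendsto_atTop_mono hk Filter.tendsto_id, hsimple,
    fun p₀ hp₀ => ⟨(1 / 2 : ℝ) ^ (1 / p₀).toReal, by positivity, fun p hp Γ _ _ n => ?_⟩⟩
  refine le_trans ?_ (hgap n p (hp₀.trans_le hp) Γ)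
  have h1 : (1 / 2 : ℝ) ^ (1 / p₀).toReal ≤ (1 / 2 : ℝ) ^ (1 / p).toReal := by
    refine Real.rpow_le_rpow_of_exponent_ge (by norm_num) (by norm_num) ?_
    exact ENNReal.toReal_mono (by simp [hp₀.ne']) (ENNReal.div_le_div_left hp 1)
  have h2 : Real.log ((M n).k : ℝ) ^ Real.logb 163840 (4 / 3) ≤ (4 / 3) ^ 2 ^ n := by
    refine (Real.rpow_le_rpow (Real.log_natCast_nonneg _) (hlog n) hc.le).trans (le_of_eq ?_)
    rw [← Real.rpow_natCast, ← Real.rpow_mul (by norm_num), mul_comm, Real.rpow_mul (by norm_num),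
      Real.rpow_logb (by norm_num) (by norm_num) (by norm_num), Real.rpow_natCast]
  exact mul_le_mul h1 h2 (Real.rpow_nonneg (Real.log_natCast_nonneg _) _) (by positivity)
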